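/- **Setting.** Let $n\ge1$, $d\ge2$, let $X\in\mathbb R^{n\times d}$ be a fixed design whose columns satisfy $\max_j\|X_{*j}\|_2\le\sqrt n$, let $\beta^*\in\mathbb R^d$ with support $S$ and $s=|S|$, and let $y=X\beta^*+\epsilon$, where $\epsilon_1,\dots,\epsilon_n$ are i.i.d. centred sub-Gaussian with variance proxy $\sigma^2$, i.e. $\mathbb E e^{t\epsilon_i}\le e^{\sigma^2t^2/2}$ for all $t\in\mathbb R$. Put $\mathcal L(\beta)=(2n)^{-1}\|y-X\beta\|_2^2$. For $\Lambda\in\mathbb R^d$ call $\beta$ an *$\varepsilon$-optimal solution with weights $\Lambda$* if $\min_{\xi\in\partial\|\beta\|_1}\|\nabla\mathcal L(\beta)+\Lambda\odot\xi\|_\infty\le\varepsilon$. Given $\lambda,\varepsilon_c,\varepsilon_t$ and $w$, let $\widetilde\beta^{(1)}$ be any $\varepsilon_c$-optimal solution with weights $\lambda\mathbf 1$ (or with weights $\lambda w(0)\mathbf 1$, corresponding to the initial value $\widetilde\beta^{(0)}=0$), and for $1\le\ell<T$ let $\widetilde\beta^{(\ell+1)}$ be any $\varepsilon_t$-optimal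 solution with weights $\big(\lambda w(|\widetilde\beta^{(\ell)}_j|)\big)_{j\le d}$. For $m\in\mathbb N$ and $r\in\mathbb R$ let $\rho_+(m,r)$ and $\rho_-(m,r)$ be the supremum and the infimum of $u_J^{\rm T}\nabla^2\mathcal L(\beta)u_J$ over all $u,\beta\in\mathbb R^d$ and $J\subseteq\{1,\dots,d\}$ with $\|u_J\|_2=1$, $|J|\le m$, $\|\beta-\beta^*\|_2\le r$. **Assumptions.** Let $\delta\in(0,1)$ and $0<\rho_*\le\rho^*<\infty$. (A1) There are an integer $\tilde s\ge 2s$ and some $r$ with $\rho_*\le\rho_-(2s+2\tilde s,r)\le\rho_+(2s+2\tilde s,r)\le\rho^*$ and $\rho_+(\tilde s,r)/\rho_-(2s+2\tilde s,r)\le 1+\tfrac1{100}\,\tilde s/s$. (A2) $w$ is non-increasing on $[0,\infty)$ with values in $[0,1]$ there, and $w(u)\ge\frac12$ for $u=18\rho_*^{-1}\delta^{-1}\lambda$. (A3) There is $\gamma>0$ with $\min_{j\in S}|\beta^*_j|\ge u+\gamma\lambda$ and $w(\gamma\lambda)=0$. **Claim.** For every $\delta\in(0,1)$ there is $c_T>0$,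 and for every $\sigma>0$ there is $c_0>0$, such that for all $c_2\ge c_1\ge c_0$ and $0<\rho_*\le\rho^*$ there are positive constants $\eta_1,\eta_2,K$ (depending only on $\delta,\sigma,c_1,c_2,\rho_*,\rho^*$) with the following property. In the above setting, under (A1)–(A3), if $$c_1\sqrt{\tfrac{\log d}{n}}\le\lambda\le c_2\sqrt{\tfrac{\log d}{n}},\qquad \varepsilon_c\le\tfrac{\lambda}{8},\qquad \varepsilon_t\le\sqrt{\tfrac1n},\qquad T\ge1,\quad T\ge c_T\log\log d,$$ then there is an event of probability at least $1-2d^{-\eta_1}-2\exp(-\eta_2 s)$ on which every such sequence $\widetilde\beta^{(1)},\dots,\widetilde\beta^{(T)}$ satisfies $$\|\widetilde\beta^{(T)}-\beta^*\|_2\le K\sqrt{s/n}.$$ -/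

import Mathlib

open MeasureTheory ProbabilityTheory

noncomputable section

namespace ILAMM

/-- `supp β = {j : β_j ≠ 0}`. -/
def supp {d : ℕ} (β : EuclideanSpace ℝ (Fin d)) : Finset (Fin d) :=
  Finset.univ.filter fun j => β j ≠ 0

/-- The vector `u_J`, equal to `u` on `J` and zero elsewhere. -/
def restrict {d : ℕ} (J : Finset (Fin d)) (u : EuclideanSpace ℝ (Fin d)) :
    EuclideanSpace ℝ (Fin d) :=
  WithLp.toLp 2 fun j => if j ∈ J then u j else 0

def l1Norm {d : ℕ} (β : EuclideanSpace ℝ (Fin d)) : ℝ := ∑ j, |β j|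

/-- The set of subgradients of `f` at `x₀`. -/
def subdifferential {d : ℕ} (f : EuclideanSpace ℝ (Fin d) → ℝ) (x₀ : EuclideanSpace ℝ (Fin d)) :
    Set (EuclideanSpace ℝ (Fin d)) :=
  {ξ | ∀ x, inner ℝ ξ (x - x₀) ≤ f x - f x₀}

/-- The suboptimality measure `ω_Λ(β) = min_{ξ ∈ ∂‖β‖₁} ‖∇L(β) + Λ ⊙ ξ‖_∞`
(the norm of a function `Fin d → ℝ` is the supremum norm). -/
def suboptimality {d : ℕ} (L : EuclideanSpace ℝ (Fin d) → ℝ) (Λ : Fin d → ℝ)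
    (β : EuclideanSpace ℝ (Fin d)) : ℝ :=
  sInf ((fun ξ : EuclideanSpace ℝ (Fin d) => ‖(fun j => gradient L β j + Λ j * ξ j : Fin d → ℝ)‖) ''
    subdifferential l1Norm β)

/-- `β` is an `ε`-optimal solution of `min_β L(β) + ‖Λ ⊙ β‖₁`. -/
def IsEpsOptimal {d : ℕ} (L : EuclideanSpace ℝ (Fin d) → ℝ) (Λ : Fin d → ℝ) (ε : ℝ)
    (β : EuclideanSpace ℝ (Fin d)) : Prop :=
  suboptimality L Λ β ≤ ε

/-- The tightening function class. Only the values on `[0, ∞)` ever enter, so nothing is asked of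
the values at negative arguments. -/
structure IsTighteningFunction (w : ℝ → ℝ) : Prop where
  antitone : ∀ t₁ t₂ : ℝ, 0 ≤ t₂ → t₂ ≤ t₁ → w t₁ ≤ w t₂
  nonneg : ∀ t : ℝ, 0 ≤ t → 0 ≤ w t
  le_one : ∀ t : ℝ, 0 ≤ t → w t ≤ 1

/-- The adaptive weights `(λ w(|β_1|), …, λ w(|β_d|))`. -/
def adaptiveWeights {d : ℕ} (lam : ℝ) (w : ℝ → ℝ) (β : EuclideanSpace ℝ (Fin d)) : Fin d → ℝ :=
  fun j => lam * w |β j|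

/-- `b 1, …, b T` are possible outputs of the successive stages of tightening after contraction:
`b 1` solves the contraction problem, with weights `Λ₀`, up to `εc`, and each further `b (ℓ + 1)`
solves, up to `εt`, the problem whose weights are computed from `b ℓ`. -/
structure IsTACSequence {d : ℕ} (L : EuclideanSpace ℝ (Fin d) → ℝ) (lam : ℝ) (w : ℝ → ℝ)
    (Λ₀ : Fin d → ℝ) (εc εt : ℝ) (T : ℕ) (b : ℕ → EuclideanSpace ℝ (Fin d)) : Prop where
  contraction : IsEpsOptimal L Λ₀ εc (b 1)
  tightening : ∀ ℓ : ℕ, 1 ≤ ℓ → ℓ < T →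
    IsEpsOptimal L (adaptiveWeights lam w (b ℓ)) εt (b (ℓ + 1))

/-- The quadratic form `vᵀ ∇²L(β) v`. -/
def hessianForm {d : ℕ} (L : EuclideanSpace ℝ (Fin d) → ℝ) (β v : EuclideanSpace ℝ (Fin d)) : ℝ :=
  fderiv ℝ (fderiv ℝ L) β v v

/-- The values over which the localized sparse eigenvalues are taken. -/
def localizedSparseValues {d : ℕ} (L : EuclideanSpace ℝ (Fin d) → ℝ)
    (βstar : EuclideanSpace ℝ (Fin d)) (m : ℕ) (r : ℝ) : Set ℝ :=
  {q | ∃ (J : Finset (Fin d)) (u β : EuclideanSpace ℝ (Fin d)),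
    ‖restrict J u‖ ^ 2 = 1 ∧ J.card ≤ m ∧ ‖β - βstar‖ ≤ r ∧ q = hessianForm L β (restrict J u)}

/-- `ρ₊(m, r)`. -/
def rhoPlus {d : ℕ} (L : EuclideanSpace ℝ (Fin d) → ℝ)
    (βstar : EuclideanSpace ℝ (Fin d)) (m : ℕ) (r : ℝ) : ℝ :=
  sSup (localizedSparseValues L βstar m r)

/-- `ρ₋(m, r)`. -/
def rhoMinus {d : ℕ} (L : EuclideanSpace ℝ (Fin d) → ℝ)
    (βstar : EuclideanSpace ℝ (Fin d)) (m : ℕ) (r : ℝ) : ℝ :=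
  sInf (localizedSparseValues L βstar m r)

/-- The localized sparse eigenvalue condition with bounds `ρlo`, `ρhi` and constants `c`, `C`;
here `s = ‖β*‖₀`. -/
def LSECondition {d : ℕ} (L : EuclideanSpace ℝ (Fin d) → ℝ) (βstar : EuclideanSpace ℝ (Fin d))
    (ρlo ρhi c C : ℝ) : Prop :=
  ∃ (st : ℕ) (r : ℝ),
    c * ((supp βstar).card : ℝ) ≤ (st : ℝ) ∧
    0 < ρlo ∧
    ρlo ≤ rhoMinus L βstar (2 * (supp βstar).card + 2 * st) r ∧
    rhoMinus L βstar (2 * (supp βstar).card + 2 * st) r ≤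
      rhoPlus L βstar (2 * (supp βstar).card + 2 * st) r ∧
    rhoPlus L βstar (2 * (supp βstar).card + 2 * st) r ≤ ρhi ∧
    rhoPlus L βstar st r / rhoMinus L βstar (2 * (supp βstar).card + 2 * st) r ≤
      1 + C * (st : ℝ) / ((supp βstar).card : ℝ)

/-- The quadratic loss `(2n)⁻¹ ‖y - Xβ‖₂²`. -/
def quadLoss {n d : ℕ} (X : Matrix (Fin n) (Fin d) ℝ) (y : EuclideanSpace ℝ (Fin n))
    (β : EuclideanSpace ℝ (Fin d)) : ℝ :=
  (2 * (n : ℝ))⁻¹ * ‖y - Matrix.toEuclideanLin X β‖ ^ 2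

/-- The response vector `y = Xβ* + e` of the linear model. -/
def response {n d : ℕ} (X : Matrix (Fin n) (Fin d) ℝ) (βstar : EuclideanSpace ℝ (Fin d))
    (e : Fin n → ℝ) : EuclideanSpace ℝ (Fin n) :=
  Matrix.toEuclideanLin X βstar + WithLp.toLp 2 e

end ILAMM

end

/-! Let `E ⊇ S` consist of the coordinates that are in the support or large in the current iterate.
Off `E` the weights of the next stage are still at least `lam / 2`, so its error `v` lies in the
cone `‖v_Eᶜ‖₁ ≤ 6 √s ‖v_E‖`, on which sparse eigenvalues give restricted ones by shelling. Hence
`ρ ‖v‖` is at most a constant times `‖score_S‖ + ε √s + ‖Λ_S‖` plus the noise on `E \ S`. A false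
discovery, and a coordinate of `S` whose weight does not vanish, must each have been missed by at
least `u` in the current iterate, so these contributions cost at most half of the current error.
After `log log d` stages the `√(s log d / n)` error of the lasso stage has therefore dropped to the
order of `‖score_S‖ + √(s / n)`. Finally `‖score_S‖²` is a sub-Gaussian quadratic form of rank
at most `s`, and averaging its exponential moments over a Gaussian direction shows
`‖score_S‖ ≲ √(s / n)` outside an event of probability `exp (-s)`. -/

namespace ILAMM

section Shelling

variable {ι : Type*} [DecidableEq ι]

theorem exists_subset_card_eq_forall_sdiff_le {α : Type*} [LinearOrder α] (a : ι → α)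
    (F : Finset ι) : ∀ m ≤ F.card, ∃ J ⊆ F, J.card = m ∧ ∀ j ∈ J, ∀ k ∈ F \ J, a k ≤ a j
  | 0, _ => ⟨∅, by simp, by simp, by simp⟩
  | m + 1, hm => by
    obtain ⟨J, hJF, hJ, htop⟩ := exists_subset_card_eq_forall_sdiff_le a F m (by omega)
    have hne : (F \ J).Nonempty := by
      rw [← Finset.card_pos, Finset.card_sdiff_of_subset hJF]
      omega
    obtain ⟨k, hk, hmax⟩ := Finset.exists_max_image (F \ J) a hne
    obtain ⟨hkF, hkJ⟩ := Finset.mem_sdiff.1 hk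
    refine ⟨insert k J, Finset.insert_subset hkF hJF, by rw [Finset.card_insert_of_notMem hkJ, hJ],
      fun j hj l hl => ?_⟩
    have hl' : l ∈ F \ J := Finset.sdiff_subset_sdiff subset_rfl (Finset.subset_insert k J) hl
    rcases Finset.mem_insert.1 hj with rfl | hj
    · exact hmax l hl'
    · exact htop j hj l hl'

theorem exists_subset_card_eq_min_forall_mul_le_sum (a : ι → ℝ) (F : Finset ι) (m : ℕ) :
    ∃ J ⊆ F, J.card = min m F.card ∧ ∀ k ∈ F \ J, m * a k ≤ ∑ j ∈ J, a j := by
  rcases le_total F.card m with h | h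
  · exact ⟨F, subset_rfl, (min_eq_right h).symm, by simp⟩
  · obtain ⟨J, hJF, rfl, htop⟩ := exists_subset_card_eq_forall_sdiff_le a F m h
    refine ⟨J, hJF, (min_eq_left h).symm, fun k hk => ?_⟩
    rw [← nsmul_eq_mul]
    exact Finset.card_nsmul_le_sum J a (a k) fun j hj => htop j hj k hk

/-- The shelling argument: peel off the `m` largest entries of `a` again and again, each block
being bounded in supremum by the average of the previous one. -/
theorem subadditive_le_of_sparse_le {a : ι → ℝ} (ha : ∀ j, 0 ≤ a j) {m : ℕ} (hm : 0 < m)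
    {φ : Finset ι → ℝ} (hφ : ∀ K L, Disjoint K L → φ (K ∪ L) ≤ φ K + φ L) {M : ℝ}
    {F : Finset ι}
    (hsparse : ∀ K ⊆ F, K.card ≤ m → ∀ b : ℝ, 0 ≤ b → (∀ j ∈ K, a j ≤ b) → φ K ≤ M * b)
    {b : ℝ} (hb : 0 ≤ b) (hab : ∀ j ∈ F, a j ≤ b) :
    φ F ≤ M * (b + (∑ j ∈ F, a j) / m) := by
  induction F using Finset.strongInduction generalizing b with
  | H F ih =>
    rcases F.eq_empty_or_nonempty with rfl | hF
    · simpa using hsparse ∅ subset_rfl (by simp) b hb (by simp)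
    have hm' : (0 : ℝ) < m := by exact_mod_cast hm
    obtain ⟨J, hJF, hJ, havg⟩ := exists_subset_card_eq_min_forall_mul_le_sum a F m
    have hJne : J.Nonempty := Finset.card_pos.1 (hJ ▸ lt_min hm hF.card_pos)
    have hrest : φ (F \ J) ≤ M * ((∑ j ∈ J, a j) / m + (∑ j ∈ F \ J, a j) / m) :=
      ih (F \ J) (Finset.sdiff_ssubset hJF hJne)
        (fun K hK => hsparse K (hK.trans Finset.sdiff_subset))
        (div_nonneg (Finset.sum_nonneg fun j _ => ha j) hm'.le)
        fun k hk => (le_div_iff₀' hm').2 (havg k hk)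
    have hblock : φ J ≤ M * b :=
      hsparse J hJF (hJ ▸ min_le_left _ _) b hb fun j hj => hab j (hJF hj)
    calc φ F = φ (J ∪ F \ J) := by rw [Finset.union_sdiff_of_subset hJF]
      _ ≤ φ J + φ (F \ J) := hφ _ _ Finset.disjoint_sdiff
      _ ≤ M * b + M * ((∑ j ∈ J, a j) / m + (∑ j ∈ F \ J, a j) / m) := add_le_add hblock hrest
      _ = M * (b + (∑ j ∈ F, a j) / m) := by
        rw [← mul_add, ← add_div, add_comm (∑ j ∈ J, a j), Finset.sum_sdiff hJF]

theorem exists_superset_forall_compl_le [Fintype ι] {a : ι → ℝ} (ha : ∀ j, 0 ≤ a j)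
    (E : Finset ι) {m : ℕ} (hm : 0 < m) :
    ∃ I, E ⊆ I ∧ I.card ≤ E.card + m ∧ ∃ b, 0 ≤ b ∧ (∀ k ∈ Iᶜ, a k ≤ b) ∧
      m * b + ∑ k ∈ Iᶜ, a k = ∑ k ∈ Eᶜ, a k := by
  have hm' : (0 : ℝ) < m := by exact_mod_cast hm
  obtain ⟨J, hJE, hJ, havg⟩ := exists_subset_card_eq_min_forall_mul_le_sum a Eᶜ m
  have hcompl : (E ∪ J)ᶜ = Eᶜ \ J := by rw [Finset.compl_union, Finset.sdiff_eq_inter_compl]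
  refine ⟨E ∪ J, Finset.subset_union_left, (Finset.card_union_le E J).trans (by omega),
    (∑ j ∈ J, a j) / m, div_nonneg (Finset.sum_nonneg fun j _ => ha j) hm'.le, ?_, ?_⟩
  · rw [hcompl]
    exact fun k hk => (le_div_iff₀' hm').2 (havg k hk)
  · rw [hcompl, mul_div_cancel₀ _ hm'.ne', add_comm, Finset.sum_sdiff hJE]

end Shelling

section Restrict

variable {d : ℕ} {J K : Finset (Fin d)}

theorem restrict_apply (J : Finset (Fin d)) (u : EuclideanSpace ℝ (Fin d)) (j : Fin d) :
    restrict J u j = if j ∈ J then u j else 0 := rfl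

theorem norm_restrict_sq (J : Finset (Fin d)) (u : EuclideanSpace ℝ (Fin d)) :
    ‖restrict J u‖ ^ 2 = ∑ j ∈ J, u j ^ 2 := by
  simp [EuclideanSpace.real_norm_sq_eq, restrict_apply, ite_pow, Finset.sum_ite_mem]

theorem norm_restrict (J : Finset (Fin d)) (u : EuclideanSpace ℝ (Fin d)) :
    ‖restrict J u‖ = √(∑ j ∈ J, u j ^ 2) := by
  rw [← norm_restrict_sq, Real.sqrt_sq (norm_nonneg _)]

theorem restrict_union (h : Disjoint J K) (u : EuclideanSpace ℝ (Fin d)) :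
    restrict (J ∪ K) u = restrict J u + restrict K u := by
  ext j
  by_cases hJ : j ∈ J
  · simp [restrict_apply, hJ, Finset.disjoint_left.1 h hJ]
  · simp [restrict_apply, hJ]

theorem restrict_smul (J : Finset (Fin d)) (t : ℝ) (u : EuclideanSpace ℝ (Fin d)) :
    restrict J (t • u) = t • restrict J u := by
  ext j
  simp [restrict_apply]

theorem restrict_univ (u : EuclideanSpace ℝ (Fin d)) : restrict Finset.univ u = u := by
  ext j
  simp [restrict_apply]

theorem restrict_add_restrict_compl (J : Finset (Fin d)) (u : EuclideanSpace ℝ (Fin d)) :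
    restrict J u + restrict Jᶜ u = u := by
  rw [← restrict_union disjoint_compl_right, Finset.union_compl, restrict_univ]

theorem inner_restrict_restrict_of_disjoint (h : Disjoint J K) (u v : EuclideanSpace ℝ (Fin d)) :
    inner ℝ (restrict J u) (restrict K v) = 0 := by
  rw [PiLp.inner_apply]
  refine Finset.sum_eq_zero fun j _ => ?_
  by_cases hJ : j ∈ J
  · simp [restrict_apply, Finset.disjoint_left.1 h hJ]
  · simp [restrict_apply, hJ]

theorem norm_sq_eq_norm_restrict_sq_add (J : Finset (Fin d)) (u : EuclideanSpace ℝ (Fin d)) :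
    ‖u‖ ^ 2 = ‖restrict J u‖ ^ 2 + ‖restrict Jᶜ u‖ ^ 2 := by
  conv_lhs => rw [← restrict_add_restrict_compl J u]
  rw [norm_add_sq_real, inner_restrict_restrict_of_disjoint disjoint_compl_right, mul_zero,
    add_zero]

theorem norm_restrict_mono (h : J ⊆ K) (u : EuclideanSpace ℝ (Fin d)) :
    ‖restrict J u‖ ≤ ‖restrict K u‖ := by
  rw [norm_restrict, norm_restrict]
  exact Real.sqrt_le_sqrt (Finset.sum_le_sum_of_subset_of_nonneg h fun _ _ _ => sq_nonneg _)

theorem norm_restrict_le (J : Finset (Fin d)) (u : EuclideanSpace ℝ (Fin d)) :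
    ‖restrict J u‖ ≤ ‖u‖ := by
  simpa only [restrict_univ] using norm_restrict_mono (Finset.subset_univ J) u

theorem norm_restrict_le_norm_restrict {u v : EuclideanSpace ℝ (Fin d)}
    (h : ∀ j ∈ J, |u j| ≤ |v j|) : ‖restrict J u‖ ≤ ‖restrict J v‖ := by
  rw [norm_restrict, norm_restrict]
  exact Real.sqrt_le_sqrt (Finset.sum_le_sum fun j hj => sq_le_sq.2 (h j hj))

theorem norm_restrict_const (J : Finset (Fin d)) {c : ℝ} (hc : 0 ≤ c) :
    ‖restrict J (WithLp.toLp 2 fun _ => c)‖ = c * √J.card := by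
  rw [norm_restrict]
  simp [Real.sqrt_sq hc, mul_comm c]

theorem norm_restrict_le_mul_sqrt_card {u : EuclideanSpace ℝ (Fin d)} {c : ℝ} (hc : 0 ≤ c)
    (hu : ∀ j ∈ J, |u j| ≤ c) : ‖restrict J u‖ ≤ c * √J.card := by
  rw [← norm_restrict_const J hc]
  exact norm_restrict_le_norm_restrict fun j hj => (hu j hj).trans (le_abs_self c)

theorem mul_sqrt_card_le_norm_restrict {u : EuclideanSpace ℝ (Fin d)} {c : ℝ} (hc : 0 ≤ c)
    (hu : ∀ j ∈ J, c ≤ |u j|) : c * √J.card ≤ ‖restrict J u‖ := by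
  rw [← norm_restrict_const J hc]
  exact norm_restrict_le_norm_restrict fun j hj => (abs_of_nonneg hc).trans_le (hu j hj)

theorem sum_abs_mul_abs_le (J : Finset (Fin d)) (u v : EuclideanSpace ℝ (Fin d)) :
    ∑ j ∈ J, |u j| * |v j| ≤ ‖restrict J u‖ * ‖restrict J v‖ := by
  rw [norm_restrict, norm_restrict]
  simpa only [sq_abs] using Real.sum_mul_le_sqrt_mul_sqrt J (fun j => |u j|) (fun j => |v j|)

theorem eq_zero_of_sum_abs_compl_nonpos {v : EuclideanSpace ℝ (Fin d)} (hJ : restrict J v = 0)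
    (h : ∑ j ∈ Jᶜ, |v j| ≤ 0) : v = 0 := by
  have hoff : ∀ j ∈ Jᶜ, |v j| = 0 := (Finset.sum_eq_zero_iff_of_nonneg fun _ _ => abs_nonneg _).1
    (h.antisymm (Finset.sum_nonneg fun _ _ => abs_nonneg _))
  ext j
  by_cases hj : j ∈ J
  · simpa [restrict_apply, hj] using congrFun (congrArg WithLp.ofLp hJ) j
  · exact abs_eq_zero.1 (hoff j (Finset.mem_compl.2 hj))

end Restrict

section Correlation

variable {V W : Type*} [NormedAddCommGroup V] [InnerProductSpace ℝ V]
  [NormedAddCommGroup W] [InnerProductSpace ℝ W]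

theorem mul_norm_le_norm_add {a b : V} {θ : ℝ} (h : |inner ℝ a b| ≤ θ * ‖a‖ ^ 2) :
    (1 - θ) * ‖a‖ ≤ ‖a + b‖ := by
  rcases (norm_nonneg a).eq_or_lt with ha | ha
  · rw [← ha, mul_zero]
    exact norm_nonneg _
  refine le_of_mul_le_mul_left ?_ ha
  calc ‖a‖ * ((1 - θ) * ‖a‖) = ‖a‖ ^ 2 - θ * ‖a‖ ^ 2 := by ring
    _ ≤ ‖a‖ ^ 2 + inner ℝ a b := by linarith [neg_le_of_abs_le h]
    _ = inner ℝ a (a + b) := by rw [inner_add_right, real_inner_self_eq_norm_sq]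
    _ ≤ ‖a‖ * ‖a + b‖ := real_inner_le_norm _ _

theorem inner_map_sq_le (A : V →ₗ[ℝ] W) {a b : V} (hab : inner ℝ a b = 0) {ρ ρ' : ℝ}
    (hlo : ∀ t : ℝ, ρ * ‖a + t • b‖ ^ 2 ≤ ‖A (a + t • b)‖ ^ 2)
    (hhi : ‖A b‖ ^ 2 ≤ ρ' * ‖b‖ ^ 2) :
    inner ℝ (A a) (A b) ^ 2 ≤ (ρ' - ρ) * ‖b‖ ^ 2 * (‖A a‖ ^ 2 - ρ * ‖a‖ ^ 2) := by
  have hquad (t : ℝ) : 0 ≤ (ρ' - ρ) * ‖b‖ ^ 2 * (t * t) + 2 * inner ℝ (A a) (A b) * t +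
      (‖A a‖ ^ 2 - ρ * ‖a‖ ^ 2) := by
    have h := hlo t
    rw [map_add, map_smul, norm_add_sq_real, norm_add_sq_real, inner_smul_right, inner_smul_right,
      hab, norm_smul, norm_smul, mul_pow, mul_pow, Real.norm_eq_abs, sq_abs] at h
    linarith [mul_le_mul_of_nonneg_left hhi (sq_nonneg t)]
  have hdiscrim := discrim_le_zero hquad
  rw [discrim] at hdiscrim
  linarith

theorem abs_inner_map_mul_norm_le (A : V →ₗ[ℝ] W) {a b : V} (hab : inner ℝ a b = 0) {ρ κ : ℝ}
    (hκ : 0 ≤ κ) (hlo : ∀ t : ℝ, ρ * ‖a + t • b‖ ^ 2 ≤ ‖A (a + t • b)‖ ^ 2)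
    (hhi : ‖A b‖ ^ 2 ≤ ρ * (1 + κ) * ‖b‖ ^ 2) :
    |inner ℝ (A a) (A b)| * ‖a‖ ≤ √κ / 2 * ‖b‖ * ‖A a‖ ^ 2 := by
  refine abs_le_of_sq_le_sq' ?_ (by positivity) |>.2
  have hamgm : ρ * ‖a‖ ^ 2 * (‖A a‖ ^ 2 - ρ * ‖a‖ ^ 2) ≤ (‖A a‖ ^ 2) ^ 2 / 4 := by
    linarith [sq_nonneg (‖A a‖ ^ 2 - 2 * (ρ * ‖a‖ ^ 2))]
  calc (|inner ℝ (A a) (A b)| * ‖a‖) ^ 2 = inner ℝ (A a) (A b) ^ 2 * ‖a‖ ^ 2 := by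
        rw [mul_pow, sq_abs]
    _ ≤ (ρ * (1 + κ) - ρ) * ‖b‖ ^ 2 * (‖A a‖ ^ 2 - ρ * ‖a‖ ^ 2) * ‖a‖ ^ 2 := by
        gcongr
        exact inner_map_sq_le A hab hlo hhi
    _ = κ * ‖b‖ ^ 2 * (ρ * ‖a‖ ^ 2 * (‖A a‖ ^ 2 - ρ * ‖a‖ ^ 2)) := by ring
    _ ≤ κ * ‖b‖ ^ 2 * ((‖A a‖ ^ 2) ^ 2 / 4) := by gcongr
    _ = (√κ / 2 * ‖b‖ * ‖A a‖ ^ 2) ^ 2 := by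
        rw [mul_pow, mul_pow, div_pow, Real.sq_sqrt hκ]
        ring

end Correlation

section RestrictedEigenvalue

variable {d : ℕ} {W : Type*} [NormedAddCommGroup W] [InnerProductSpace ℝ W]
  {A : EuclideanSpace ℝ (Fin d) →ₗ[ℝ] W}

/-- The largest eigenvalue of `AᵀA` on `m`-sparse vectors is at most `ρ`. -/
def SparseUpperBound (A : EuclideanSpace ℝ (Fin d) →ₗ[ℝ] W) (m : ℕ) (ρ : ℝ) : Prop :=
  ∀ (J : Finset (Fin d)) (u : EuclideanSpace ℝ (Fin d)), J.card ≤ m →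
    ‖A (restrict J u)‖ ^ 2 ≤ ρ * ‖restrict J u‖ ^ 2

/-- The smallest eigenvalue of `AᵀA` on `m`-sparse vectors is at least `ρ`. -/
def SparseLowerBound (A : EuclideanSpace ℝ (Fin d) →ₗ[ℝ] W) (m : ℕ) (ρ : ℝ) : Prop :=
  ∀ (J : Finset (Fin d)) (u : EuclideanSpace ℝ (Fin d)), J.card ≤ m →
    ρ * ‖restrict J u‖ ^ 2 ≤ ‖A (restrict J u)‖ ^ 2

/-- A restricted eigenvalue condition on the `ℓ₁`-cones over the sets of at most `2 s` coordinates.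
It bounds the product `‖v‖ ‖v_E‖` and not `‖v‖ ^ 2`, as the stage bounds for the lasso are linear
in `‖v_E‖`; `6` is the cone constant of the algorithm and `5` a convenient loss. -/
def RestrictedEigenvalue (A : EuclideanSpace ℝ (Fin d) →ₗ[ℝ] W) (s : ℕ) (ρ : ℝ) : Prop :=
  ∀ (E : Finset (Fin d)) (v : EuclideanSpace ℝ (Fin d)), E.card ≤ 2 * s →
    ∑ j ∈ Eᶜ, |v j| ≤ 6 * √s * ‖restrict E v‖ → ρ * ‖v‖ * ‖restrict E v‖ ≤ 5 * ‖A v‖ ^ 2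

theorem RestrictedEigenvalue.mono {s : ℕ} {ρ ρ' : ℝ} (h : RestrictedEigenvalue A s ρ)
    (hρ : ρ' ≤ ρ) : RestrictedEigenvalue A s ρ' := fun E v hE hcone =>
  le_trans (by gcongr) (h E v hE hcone)

theorem RestrictedEigenvalue.norm_le {s : ℕ} {ρ a : ℝ} (h : RestrictedEigenvalue A s ρ)
    (ha : 0 ≤ a) {E : Finset (Fin d)} (hE : E.card ≤ 2 * s) {v : EuclideanSpace ℝ (Fin d)}
    (hcone : ∑ j ∈ Eᶜ, |v j| ≤ 6 * √s * ‖restrict E v‖) (hquad : ‖A v‖ ^ 2 ≤ a * ‖restrict E v‖) :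
    ρ * ‖v‖ ≤ 5 * a := by
  rcases (norm_nonneg (restrict E v)).eq_or_lt with h0 | hpos
  · rw [← h0, mul_zero] at hcone
    rw [eq_zero_of_sum_abs_compl_nonpos (norm_eq_zero.1 h0.symm) hcone, norm_zero]
    linarith
  · refine le_of_mul_le_mul_right ?_ hpos
    linarith [h E v hE hcone]

theorem abs_inner_map_restrict_mul_norm_le {k m : ℕ} {ρ κ : ℝ} (hκ : 0 ≤ κ)
    (hlo : SparseLowerBound A (k + m) ρ) (hhi : SparseUpperBound A m (ρ * (1 + κ)))
    {I K : Finset (Fin d)} (hI : I.card ≤ k) (hK : K.card ≤ m) (hIK : Disjoint I K)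
    (v : EuclideanSpace ℝ (Fin d)) :
    |inner ℝ (A (restrict I v)) (A (restrict K v))| * ‖restrict I v‖ ≤
      √κ / 2 * ‖restrict K v‖ * ‖A (restrict I v)‖ ^ 2 := by
  refine abs_inner_map_mul_norm_le A (inner_restrict_restrict_of_disjoint hIK v v) hκ
    (fun t => ?_) (hhi K v hK)
  have hsupp : restrict I v + t • restrict K v =
      restrict (I ∪ K) (restrict I v + t • restrict K v) := by
    ext j
    by_cases hI : j ∈ I <;> by_cases hK : j ∈ K <;> simp [restrict_apply, hI, hK]
  rw [hsupp]
  exact hlo _ _ ((Finset.card_union_le I K).trans (add_le_add hI hK))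

theorem abs_inner_map_restrict_compl_mul_norm_le {k m : ℕ} (hm : 0 < m) {ρ κ : ℝ} (hκ : 0 ≤ κ)
    (hlo : SparseLowerBound A (k + m) ρ) (hhi : SparseUpperBound A m (ρ * (1 + κ)))
    {I : Finset (Fin d)} (hI : I.card ≤ k) {v : EuclideanSpace ℝ (Fin d)} {b : ℝ} (hb : 0 ≤ b)
    (hvb : ∀ j ∈ Iᶜ, |v j| ≤ b) :
    |inner ℝ (A (restrict I v)) (A (restrict Iᶜ v))| * ‖restrict I v‖ ≤
      √κ / 2 * √m * ‖A (restrict I v)‖ ^ 2 * (b + (∑ j ∈ Iᶜ, |v j|) / m) := by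
  refine subadditive_le_of_sparse_le (a := fun j => |v j|) (fun _ => abs_nonneg _) hm
    (φ := fun K => |inner ℝ (A (restrict I v)) (A (restrict K v))| * ‖restrict I v‖)
    (fun K L hKL => ?_) (fun K hKI hK c hc hKc => ?_) hb hvb
  · rw [restrict_union hKL, map_add, inner_add_right, ← add_mul]
    gcongr
    exact abs_add_le _ _
  · have hdisj : Disjoint I K := disjoint_compl_right.mono_right hKI
    calc |inner ℝ (A (restrict I v)) (A (restrict K v))| * ‖restrict I v‖
        ≤ √κ / 2 * ‖restrict K v‖ * ‖A (restrict I v)‖ ^ 2 :=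
          abs_inner_map_restrict_mul_norm_le hκ hlo hhi hI hK hdisj v
      _ ≤ √κ / 2 * (c * √m) * ‖A (restrict I v)‖ ^ 2 := by
          gcongr
          exact (norm_restrict_le_mul_sqrt_card hc hKc).trans (by gcongr)
      _ = √κ / 2 * √m * ‖A (restrict I v)‖ ^ 2 * c := by ring

theorem norm_restrict_sq_le_mul_sum {J : Finset (Fin d)} {v : EuclideanSpace ℝ (Fin d)} {b : ℝ}
    (hvb : ∀ j ∈ J, |v j| ≤ b) : ‖restrict J v‖ ^ 2 ≤ b * ∑ j ∈ J, |v j| := by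
  rw [norm_restrict_sq, Finset.mul_sum]
  refine Finset.sum_le_sum fun j hj => ?_
  rw [← sq_abs, sq]
  exact mul_le_mul_of_nonneg_right (hvb j hj) (abs_nonneg _)

/-- Enlarging `E` by the `m` largest entries of `v` outside `E` gives a set `I` on which `A` is
well conditioned, and the shelling argument controls the interaction of `v_I` with the rest. -/
theorem exists_superset_restrict_bounds {s m : ℕ} (hm : 0 < m) {ρ κ : ℝ} (hκ : 0 ≤ κ)
    (hlo : SparseLowerBound A (2 * s + 2 * m) ρ) (hhi : SparseUpperBound A m (ρ * (1 + κ)))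
    {E : Finset (Fin d)} (hE : E.card ≤ 2 * s) (v : EuclideanSpace ℝ (Fin d)) :
    ∃ I, E ⊆ I ∧ ρ * ‖restrict I v‖ ^ 2 ≤ ‖A (restrict I v)‖ ^ 2 ∧
      4 * m * ‖restrict Iᶜ v‖ ^ 2 ≤ (∑ j ∈ Eᶜ, |v j|) ^ 2 ∧
      |inner ℝ (A (restrict I v)) (A (restrict Iᶜ v))| * ‖restrict I v‖ ≤
        √κ / 2 * √m * ‖A (restrict I v)‖ ^ 2 * ((∑ j ∈ Eᶜ, |v j|) / m) := by
  have hm' : (0 : ℝ) < m := by exact_mod_cast hm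
  obtain ⟨I, hEI, hI, b, hb, hvb, hsum⟩ :=
    exists_superset_forall_compl_le (fun j => abs_nonneg (v j)) E hm
  refine ⟨I, hEI, hlo I v (by omega), ?_, ?_⟩
  · calc 4 * m * ‖restrict Iᶜ v‖ ^ 2 ≤ 4 * m * (b * ∑ j ∈ Iᶜ, |v j|) := by
          gcongr
          exact norm_restrict_sq_le_mul_sum hvb
      _ = 4 * (m * b) * ∑ j ∈ Iᶜ, |v j| := by ring
      _ ≤ (m * b + ∑ j ∈ Iᶜ, |v j|) ^ 2 := four_mul_le_sq_add _ _
      _ = (∑ j ∈ Eᶜ, |v j|) ^ 2 := by rw [hsum]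
  · rw [← hsum, add_div, mul_div_cancel_left₀ _ hm'.ne']
    have hlo' : SparseLowerBound A (2 * s + m + m) ρ := by rwa [add_assoc, ← two_mul]
    exact abs_inner_map_restrict_compl_mul_norm_le hm hκ hlo' hhi (by omega) hb hvb

theorem norm_le_of_norm_restrict_compl_le {s m : ℕ} (hm : 2 * s ≤ m) (hm0 : 0 < m)
    {I : Finset (Fin d)} {v : EuclideanSpace ℝ (Fin d)} {N : ℝ} (hN : 0 ≤ N)
    (htail : 4 * m * ‖restrict Iᶜ v‖ ^ 2 ≤ N ^ 2) (hcone : N ≤ 6 * √s * ‖restrict I v‖) :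
    ‖v‖ ≤ 12 / 5 * ‖restrict I v‖ := by
  have hm' : 2 * (s : ℝ) ≤ m := by exact_mod_cast hm
  have hcompl : ‖restrict Iᶜ v‖ ^ 2 ≤ 9 / 2 * ‖restrict I v‖ ^ 2 := by
    refine le_of_mul_le_mul_left ?_ (by positivity : (0 : ℝ) < 4 * m)
    calc 4 * m * ‖restrict Iᶜ v‖ ^ 2 ≤ (6 * √s * ‖restrict I v‖) ^ 2 :=
          htail.trans (pow_le_pow_left₀ hN hcone 2)
      _ = 18 * (2 * s) * ‖restrict I v‖ ^ 2 := by
          rw [mul_pow, mul_pow, Real.sq_sqrt s.cast_nonneg]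
          ring
      _ ≤ 18 * m * ‖restrict I v‖ ^ 2 := by gcongr
      _ = 4 * m * (9 / 2 * ‖restrict I v‖ ^ 2) := by ring
  refine le_of_sq_le_sq ?_ (by positivity)
  rw [norm_sq_eq_norm_restrict_sq_add I v]
  linarith [sq_nonneg ‖restrict I v‖]

theorem sqrt_div_mul_sqrt_mul_div {s m : ℝ} (hs : 0 < s) (hm : 0 < m) (p : ℝ) :
    √(m / (100 * s)) / 2 * √m * (6 * √s * p / m) = 3 / 10 * p := by
  have hsqrt : √(m / (100 * s)) = √m / (10 * √s) := by
    rw [Real.sqrt_div hm.le, Real.sqrt_mul (by norm_num), show (100 : ℝ) = 10 ^ 2 by norm_num,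
      Real.sqrt_sq (by norm_num)]
  have := Real.sqrt_ne_zero'.2 hs
  rw [hsqrt]
  field_simp
  rw [Real.sq_sqrt hm.le]
  ring

theorem restrictedEigenvalue_of_sparse_bounds {s m : ℕ} (hm : 2 * s ≤ m) {ρ : ℝ} (hρ : 0 ≤ ρ)
    (hlo : SparseLowerBound A (2 * s + 2 * m) ρ)
    (hhi : SparseUpperBound A m (ρ * (1 + m / (100 * s)))) : RestrictedEigenvalue A s ρ := by
  intro E v hE hcone
  rcases (norm_nonneg (restrict E v)).eq_or_lt with hE0 | hEpos
  · rw [← hE0, mul_zero]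
    positivity
  have hs : 0 < s := by
    by_contra! h0
    have hempty : E = ∅ := by simpa [Nat.le_zero.1 h0] using hE
    simp [hempty, norm_restrict] at hEpos
  obtain ⟨I, hEI, hwell, htail, hcross⟩ := exists_superset_restrict_bounds (by omega)
    (by positivity) hlo hhi hE v
  have hEI' : ‖restrict E v‖ ≤ ‖restrict I v‖ := norm_restrict_mono hEI v
  have hcone' : ∑ j ∈ Eᶜ, |v j| ≤ 6 * √s * ‖restrict I v‖ := hcone.trans (by gcongr)
  have hnorm : ‖v‖ ≤ 12 / 5 * ‖restrict I v‖ := norm_le_of_norm_restrict_compl_le hm (by omega)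
    (Finset.sum_nonneg fun _ _ => abs_nonneg _) htail hcone'
  have hinner : |inner ℝ (A (restrict I v)) (A (restrict Iᶜ v))| ≤
      3 / 10 * ‖A (restrict I v)‖ ^ 2 := by
    refine le_of_mul_le_mul_right (hcross.trans ?_) (hEpos.trans_le hEI')
    have hconst := sqrt_div_mul_sqrt_mul_div (Nat.cast_pos.2 hs)
      (Nat.cast_pos.2 (by omega : 0 < m)) ‖restrict I v‖
    calc √(m / (100 * s)) / 2 * √m * ‖A (restrict I v)‖ ^ 2 * ((∑ j ∈ Eᶜ, |v j|) / m)
        ≤ √(m / (100 * s)) / 2 * √m * ‖A (restrict I v)‖ ^ 2 *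
            (6 * √s * ‖restrict I v‖ / m) := by gcongr
      _ = 3 / 10 * ‖A (restrict I v)‖ ^ 2 * ‖restrict I v‖ := by
          linear_combination ‖A (restrict I v)‖ ^ 2 * hconst
  have hAv : (1 - 3 / 10) * ‖A (restrict I v)‖ ≤ ‖A v‖ := by
    simpa only [← map_add, restrict_add_restrict_compl] using mul_norm_le_norm_add hinner
  calc ρ * ‖v‖ * ‖restrict E v‖ ≤ ρ * (12 / 5 * ‖restrict I v‖) * ‖restrict I v‖ := by gcongr
    _ = 12 / 5 * (ρ * ‖restrict I v‖ ^ 2) := by ring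
    _ ≤ 12 / 5 * ‖A (restrict I v)‖ ^ 2 := by gcongr
    _ ≤ 5 * ((1 - 3 / 10) * ‖A (restrict I v)‖) ^ 2 := by
        rw [mul_pow]
        linarith [sq_nonneg ‖A (restrict I v)‖]
    _ ≤ 5 * ‖A v‖ ^ 2 := by gcongr

end RestrictedEigenvalue

section Loss

variable {n d : ℕ} (X : Matrix (Fin n) (Fin d) ℝ)

/-- The design scaled by `n ^ (-1 / 2)`; its Gram matrix is the Hessian of the loss. -/
noncomputable def scaledDesign : EuclideanSpace ℝ (Fin d) →ₗ[ℝ] EuclideanSpace ℝ (Fin n) :=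
  (√n)⁻¹ • Matrix.toEuclideanLin X

/-- The gradient `-n⁻¹ Xᵀ e` of the loss at the true parameter. -/
noncomputable def score (e : Fin n → ℝ) : EuclideanSpace ℝ (Fin d) :=
  WithLp.toLp 2 (-((n : ℝ)⁻¹ • Matrix.vecMul e X))

theorem inner_scaledDesign (u v : EuclideanSpace ℝ (Fin d)) :
    inner ℝ (scaledDesign X u) (scaledDesign X v) =
      (n : ℝ)⁻¹ * inner ℝ (Matrix.toEuclideanLin X u) (Matrix.toEuclideanLin X v) := by
  rw [scaledDesign, LinearMap.smul_apply, LinearMap.smul_apply, real_inner_smul_left,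
    real_inner_smul_right, ← mul_assoc, ← mul_inv, Real.mul_self_sqrt n.cast_nonneg]

theorem inner_score (e : Fin n → ℝ) (v : EuclideanSpace ℝ (Fin d)) :
    inner ℝ (score X e) v =
      -((n : ℝ)⁻¹ * inner ℝ (WithLp.toLp 2 e) (Matrix.toEuclideanLin X v)) := by
  rw [EuclideanSpace.inner_eq_star_dotProduct, EuclideanSpace.inner_eq_star_dotProduct]
  simp [score, Matrix.toLpLin_apply, Matrix.dotProduct_mulVec, dotProduct_comm]

theorem hasFDerivAt_quadLoss (y : EuclideanSpace ℝ (Fin n)) (β : EuclideanSpace ℝ (Fin d)) :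
    HasFDerivAt (quadLoss X y) ((n : ℝ)⁻¹ • (innerSL ℝ (Matrix.toEuclideanLin X β - y)).comp
      (Matrix.toEuclideanLin X).toContinuousLinearMap) β := by
  have h := (((Matrix.toEuclideanLin X).toContinuousLinearMap.hasFDerivAt (x := β)).const_sub
    y).norm_sq.const_mul (2 * (n : ℝ))⁻¹
  refine h.congr_fderiv ?_
  ext v
  simp
  ring

theorem fderiv_quadLoss_apply (y : EuclideanSpace ℝ (Fin n)) (β v : EuclideanSpace ℝ (Fin d)) :
    fderiv ℝ (quadLoss X y) β v =
      (n : ℝ)⁻¹ * inner ℝ (Matrix.toEuclideanLin X β - y) (Matrix.toEuclideanLin X v) := by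
  rw [(hasFDerivAt_quadLoss X y β).fderiv]
  rfl

theorem hessianForm_quadLoss (y : EuclideanSpace ℝ (Fin n)) (β v : EuclideanSpace ℝ (Fin d)) :
    hessianForm (quadLoss X y) β v = ‖scaledDesign X v‖ ^ 2 := by
  have hderiv : fderiv ℝ (quadLoss X y) = fun β => (n : ℝ)⁻¹ •
      (innerSL ℝ (Matrix.toEuclideanLin X β - y)).comp
        (Matrix.toEuclideanLin X).toContinuousLinearMap :=
    funext fun β => (hasFDerivAt_quadLoss X y β).fderiv
  have hinner := (innerSL ℝ (E := EuclideanSpace ℝ (Fin n))).hasFDerivAt.comp β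
    (((Matrix.toEuclideanLin X).toContinuousLinearMap.hasFDerivAt (x := β)).sub_const y)
  have hsecond := (hinner.clm_comp
    (hasFDerivAt_const (Matrix.toEuclideanLin X).toContinuousLinearMap β)).const_smul (n : ℝ)⁻¹
  rw [hessianForm, hderiv, ← real_inner_self_eq_norm_sq, inner_scaledDesign]
  refine (congrArg (fun D => D v v) hsecond.fderiv).trans ?_
  rw [ContinuousLinearMap.comp_zero, zero_add]
  rfl

theorem inner_gradient_quadLoss (βstar : EuclideanSpace ℝ (Fin d)) (e : Fin n → ℝ)
    (β v : EuclideanSpace ℝ (Fin d)) :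
    inner ℝ (gradient (quadLoss X (response X βstar e)) β) v =
      inner ℝ (scaledDesign X (β - βstar)) (scaledDesign X v) + inner ℝ (score X e) v := by
  rw [gradient, InnerProductSpace.toDual_symm_apply, fderiv_quadLoss_apply, inner_scaledDesign,
    inner_score, map_sub, response, ← sub_sub, inner_sub_left _ (WithLp.toLp 2 e), mul_sub,
    sub_eq_add_neg]

end Loss

section SparseEigenvalues

variable {n d : ℕ} {X : Matrix (Fin n) (Fin d) ℝ} {y : EuclideanSpace ℝ (Fin n)}
  {βstar : EuclideanSpace ℝ (Fin d)} {m : ℕ} {r ρ : ℝ}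

theorem bddAbove_localizedSparseValues :
    BddAbove (localizedSparseValues (quadLoss X y) βstar m r) := by
  refine ⟨‖(scaledDesign X).toContinuousLinearMap‖ ^ 2, ?_⟩
  rintro _ ⟨J, u, β, hu, -, -, rfl⟩
  have hop := (scaledDesign X).toContinuousLinearMap.le_opNorm (restrict J u)
  calc hessianForm (quadLoss X y) β (restrict J u) = ‖scaledDesign X (restrict J u)‖ ^ 2 :=
        hessianForm_quadLoss X y β _
    _ ≤ (‖(scaledDesign X).toContinuousLinearMap‖ * ‖restrict J u‖) ^ 2 :=
        pow_le_pow_left₀ (norm_nonneg _) hop 2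
    _ = ‖(scaledDesign X).toContinuousLinearMap‖ ^ 2 := by rw [mul_pow, hu, mul_one]

theorem bddBelow_localizedSparseValues :
    BddBelow (localizedSparseValues (quadLoss X y) βstar m r) := by
  refine ⟨0, ?_⟩
  rintro _ ⟨J, u, β, -, -, -, rfl⟩
  rw [hessianForm_quadLoss]
  positivity

theorem norm_sq_div_mem_localizedSparseValues (hr : 0 ≤ r) {J : Finset (Fin d)} (hJ : J.card ≤ m)
    {u : EuclideanSpace ℝ (Fin d)} (hu : restrict J u ≠ 0) :
    ‖scaledDesign X (restrict J u)‖ ^ 2 / ‖restrict J u‖ ^ 2 ∈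
      localizedSparseValues (quadLoss X y) βstar m r := by
  refine ⟨J, ‖restrict J u‖⁻¹ • u, βstar, ?_, hJ, by simpa using hr, ?_⟩
  · rw [restrict_smul, norm_smul, norm_inv, norm_norm, inv_mul_cancel₀ (norm_ne_zero_iff.2 hu),
      one_pow]
  · rw [hessianForm_quadLoss, restrict_smul, map_smul, norm_smul, norm_inv, norm_norm, mul_pow,
      inv_pow, div_eq_inv_mul]

theorem sparseUpperBound_of_rhoPlus_le (hr : 0 ≤ r) (h : rhoPlus (quadLoss X y) βstar m r ≤ ρ) :
    SparseUpperBound (scaledDesign X) m ρ := by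
  intro J u hJ
  rcases eq_or_ne (restrict J u) 0 with hu | hu
  · simp [hu]
  · rw [← div_le_iff₀ (by positivity)]
    exact (le_csSup bddAbove_localizedSparseValues
      (norm_sq_div_mem_localizedSparseValues hr hJ hu)).trans h

theorem sparseLowerBound_rhoMinus (hr : 0 ≤ r) :
    SparseLowerBound (scaledDesign X) m (rhoMinus (quadLoss X y) βstar m r) := by
  intro J u hJ
  rcases eq_or_ne (restrict J u) 0 with hu | hu
  · simp [hu]
  · rw [← le_div_iff₀ (by positivity)]
    exact csInf_le bddBelow_localizedSparseValues
      (norm_sq_div_mem_localizedSparseValues hr hJ hu)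

theorem nonneg_of_rhoMinus_ne_zero {L : EuclideanSpace ℝ (Fin d) → ℝ}
    (h : rhoMinus L βstar m r ≠ 0) : 0 ≤ r := by
  have hne : (localizedSparseValues L βstar m r).Nonempty := by
    by_contra hempty
    rw [Set.not_nonempty_iff_eq_empty] at hempty
    exact h (by rw [rhoMinus, hempty, Real.sInf_empty])
  obtain ⟨_, _, _, β, -, -, hβ, -⟩ := hne
  exact (norm_nonneg _).trans hβ

theorem LSECondition.restrictedEigenvalue {ρlo ρhi : ℝ}
    (h : LSECondition (quadLoss X y) βstar ρlo ρhi 2 (1 / 100)) :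
    RestrictedEigenvalue (scaledDesign X) (supp βstar).card ρlo := by
  obtain ⟨m, r, hm, hpos, hlo, -, -, hratio⟩ := h
  have hpos' := hpos.trans_le hlo
  have hr := nonneg_of_rhoMinus_ne_zero hpos'.ne'
  rw [div_le_iff₀' hpos', mul_comm_div, one_mul, div_div] at hratio
  exact (restrictedEigenvalue_of_sparse_bounds (by exact_mod_cast hm) hpos'.le
    (sparseLowerBound_rhoMinus hr) (sparseUpperBound_of_rhoPlus_le hr hratio)).mono hlo

theorem LSECondition.sparseUpperBound {ρlo ρhi C : ℝ}
    (h : LSECondition (quadLoss X y) βstar ρlo ρhi 2 C) :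
    SparseUpperBound (scaledDesign X) (supp βstar).card ρhi := by
  obtain ⟨m, r, -, hpos, hlo, -, hhi, -⟩ := h
  have hr := nonneg_of_rhoMinus_ne_zero (hpos.trans_le hlo).ne'
  exact fun J u hJ => sparseUpperBound_of_rhoPlus_le hr hhi J u (by omega)

end SparseEigenvalues

section Subgradient

variable {d : ℕ} {β ξ : EuclideanSpace ℝ (Fin d)}

theorem sign_mem_subdifferential (β : EuclideanSpace ℝ (Fin d)) :
    (WithLp.toLp 2 fun j => (SignType.sign (β j) : ℝ)) ∈ subdifferential l1Norm β := by
  intro x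
  rw [l1Norm, l1Norm, ← Finset.sum_sub_distrib, PiLp.inner_apply]
  refine Finset.sum_le_sum fun j _ => ?_
  calc inner ℝ ((SignType.sign (β j) : ℝ)) ((x - β) j)
      = SignType.sign (β j) * x j - |β j| := by
        rw [PiLp.sub_apply, inner_sub_right, ← sign_mul_self (β j)]
        simp [mul_comm]
    _ ≤ |x j| - |β j| := by
        gcongr
        rcases lt_trichotomy (β j) 0 with h | h | h
        · simpa [sign_neg h] using neg_le_abs (x j)
        · simp [h]
        · simpa [sign_pos h] using le_abs_self (x j)

theorem mul_le_abs_add_sub_abs_of_mem_subdifferential (hξ : ξ ∈ subdifferential l1Norm β)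
    (j : Fin d) (t : ℝ) : ξ j * t ≤ |β j + t| - |β j| := by
  have hl1 : l1Norm (β + EuclideanSpace.single j t) - l1Norm β = |β j + t| - |β j| := by
    rw [l1Norm, l1Norm, ← Finset.sum_sub_distrib, Finset.sum_eq_single j]
    · simp
    · intro k _ hk
      simp [hk]
    · simp
  have h := hξ (β + EuclideanSpace.single j t)
  rw [add_sub_cancel_left, EuclideanSpace.inner_single_right, hl1] at h
  simpa [mul_comm] using h

theorem abs_le_one_of_mem_subdifferential (hξ : ξ ∈ subdifferential l1Norm β) (j : Fin d) :
    |ξ j| ≤ 1 := by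
  have hplus := mul_le_abs_add_sub_abs_of_mem_subdifferential hξ j 1
  have hminus := mul_le_abs_add_sub_abs_of_mem_subdifferential hξ j (-1)
  have hplus' := abs_add_le (β j) 1
  have hminus' := abs_add_le (β j) (-1)
  rw [abs_neg] at hminus'
  rw [abs_one] at hplus' hminus'
  exact abs_le.2 ⟨by linarith, by linarith⟩

theorem mul_eq_abs_of_mem_subdifferential (hξ : ξ ∈ subdifferential l1Norm β) (j : Fin d) :
    ξ j * β j = |β j| := by
  refine le_antisymm ?_ ?_
  · calc ξ j * β j ≤ |ξ j| * |β j| := (le_abs_self _).trans_eq (abs_mul _ _)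
      _ ≤ |β j| :=
        mul_le_of_le_one_left (abs_nonneg _) (abs_le_one_of_mem_subdifferential hξ j)
  · have h := mul_le_abs_add_sub_abs_of_mem_subdifferential hξ j (-β j)
    rw [add_neg_cancel, abs_zero] at h
    linarith

/-- The slack `ε < ε'` spares the compactness argument showing that the infimum is attained. -/
theorem IsEpsOptimal.exists_subgradient {L : EuclideanSpace ℝ (Fin d) → ℝ} {Λ : Fin d → ℝ}
    {ε ε' : ℝ} (h : IsEpsOptimal L Λ ε β) (hε : ε < ε') :
    ∃ ξ ∈ subdifferential l1Norm β, ∀ j, |gradient L β j + Λ j * ξ j| ≤ ε' := by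
  obtain ⟨_, ⟨ξ, hξ, rfl⟩, hlt⟩ := exists_lt_of_csInf_lt
    (Set.Nonempty.image _ ⟨_, sign_mem_subdifferential β⟩) (h.trans_lt hε)
  exact ⟨ξ, hξ, fun j =>
    (norm_le_pi_norm (fun j => gradient L β j + Λ j * ξ j) j).trans hlt.le⟩

end Subgradient

section Stage

variable {n d : ℕ} {X : Matrix (Fin n) (Fin d) ℝ} {βstar : EuclideanSpace ℝ (Fin d)}
  {e : Fin n → ℝ} {ρ lam ε : ℝ} {Λ : Fin d → ℝ} {β : EuclideanSpace ℝ (Fin d)}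

theorem notMem_supp {j : Fin d} : j ∉ supp βstar ↔ βstar j = 0 := by
  simp [supp]

theorem sub_apply_of_notMem_supp {j : Fin d} (hj : j ∉ supp βstar) : (β - βstar) j = β j := by
  rw [PiLp.sub_apply, notMem_supp.1 hj, sub_zero]

/-- Everything apart from `‖v_E‖` in the bound for a stage with weights `Λ`, tolerance `ε` and
gradient `g` at the true parameter of support `S`, where `E ⊇ S` collects the coordinates on which
no lower bound for the weights is available. -/
noncomputable def effectiveNoise (g : EuclideanSpace ℝ (Fin d)) (Λ : Fin d → ℝ) (ε : ℝ)
    (S E : Finset (Fin d)) : ℝ :=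
  ‖restrict E g‖ + ε * √E.card + ‖restrict S (WithLp.toLp 2 Λ)‖

theorem effectiveNoise_nonneg (g : EuclideanSpace ℝ (Fin d)) (hε : 0 ≤ ε) (S E : Finset (Fin d)) :
    0 ≤ effectiveNoise g Λ ε S E := by
  rw [effectiveNoise]
  positivity

theorem sum_le_effectiveNoise_mul {g v : EuclideanSpace ℝ (Fin d)} (hε : 0 ≤ ε)
    {S E : Finset (Fin d)} (hSE : S ⊆ E) :
    ∑ j ∈ E, (ε + |g j|) * |v j| + ∑ j ∈ S, Λ j * |v j| ≤
      effectiveNoise g Λ ε S E * ‖restrict E v‖ := by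
  have hnoise : ∑ j ∈ E, |g j| * |v j| ≤ ‖restrict E g‖ * ‖restrict E v‖ :=
    sum_abs_mul_abs_le E g v
  have htol : ∑ j ∈ E, ε * |v j| ≤ ε * √E.card * ‖restrict E v‖ := by
    simpa only [abs_of_nonneg hε, norm_restrict_const E hε] using
      sum_abs_mul_abs_le E (WithLp.toLp 2 fun _ => ε) v
  have hweights : ∑ j ∈ S, Λ j * |v j| ≤ ‖restrict S (WithLp.toLp 2 Λ)‖ * ‖restrict E v‖ :=
    calc ∑ j ∈ S, Λ j * |v j| ≤ ∑ j ∈ S, |Λ j| * |v j| := by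
          gcongr
          exact le_abs_self _
      _ ≤ ‖restrict S (WithLp.toLp 2 Λ)‖ * ‖restrict S v‖ :=
          sum_abs_mul_abs_le S (WithLp.toLp 2 Λ) v
      _ ≤ ‖restrict S (WithLp.toLp 2 Λ)‖ * ‖restrict E v‖ := by
          gcongr
          exact norm_restrict_mono hSE v
  simp only [effectiveNoise, add_mul, Finset.sum_add_distrib]
  linarith

theorem sqrt_card_le {E : Finset (Fin d)} {s : ℕ} (hE : E.card ≤ 2 * s) :
    √E.card ≤ 3 / 2 * √s := by
  have hE' : (E.card : ℝ) ≤ 2 * s := by exact_mod_cast hE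
  rw [Real.sqrt_le_left (by positivity), mul_pow, Real.sq_sqrt s.cast_nonneg]
  linarith [(Nat.cast_nonneg s : (0 : ℝ) ≤ s)]

theorem effectiveNoise_le {g : EuclideanSpace ℝ (Fin d)} (hg : ∀ j, |g j| ≤ lam / 16)
    (hlam : 0 ≤ lam) (hε : ε ≤ 3 / 16 * lam) (hΛ : ∀ j, Λ j ∈ Set.Icc 0 lam)
    {S E : Finset (Fin d)} (hE : E.card ≤ 2 * S.card) :
    effectiveNoise g Λ ε S E ≤ 3 / 2 * lam * √S.card := by
  have hnoise : ‖restrict E g‖ ≤ lam / 16 * √E.card :=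
    norm_restrict_le_mul_sqrt_card (by positivity) fun j _ => hg j
  have hweights : ‖restrict S (WithLp.toLp 2 Λ)‖ ≤ lam * √S.card :=
    norm_restrict_le_mul_sqrt_card hlam fun j _ => (abs_of_nonneg (hΛ j).1).trans_le (hΛ j).2
  calc effectiveNoise g Λ ε S E
      ≤ lam / 16 * √E.card + 3 / 16 * lam * √E.card + lam * √S.card := by
        rw [effectiveNoise]
        gcongr
    _ = lam / 4 * √E.card + lam * √S.card := by ring
    _ ≤ lam / 4 * (3 / 2 * √S.card) + lam * √S.card := by
        gcongr
        exact sqrt_card_le hE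
    _ ≤ 3 / 2 * lam * √S.card := by linarith [mul_nonneg hlam (Real.sqrt_nonneg S.card)]

theorem norm_sq_add_sum_le {ξ : EuclideanSpace ℝ (Fin d)} (hξ : ξ ∈ subdifferential l1Norm β)
    (hΛ : ∀ j, 0 ≤ Λ j)
    (hopt : ∀ j, |gradient (quadLoss X (response X βstar e)) β j + Λ j * ξ j| ≤ ε) :
    ‖scaledDesign X (β - βstar)‖ ^ 2 + ∑ j ∈ (supp βstar)ᶜ, Λ j * |(β - βstar) j| ≤
      ∑ j, (ε + |score X e j|) * |(β - βstar) j| +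
        ∑ j ∈ supp βstar, Λ j * |(β - βstar) j| := by
  set v := β - βstar with hv
  set G := gradient (quadLoss X (response X βstar e)) β
  set g := score X e
  have hid : ‖scaledDesign X v‖ ^ 2 = ∑ j, (G j - g j) * v j := by
    have hinner : inner ℝ (G - g) v = ‖scaledDesign X v‖ ^ 2 := by
      rw [inner_sub_left, inner_gradient_quadLoss, add_sub_cancel_right, real_inner_self_eq_norm_sq]
    rw [← hinner, PiLp.inner_apply]
    exact Finset.sum_congr rfl fun j _ => by simp [mul_comm]
  have hcoord (j : Fin d) : (G j - g j) * v j ≤ (ε + |g j|) * |v j| - Λ j * (ξ j * v j) := by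
    have hres : (G j + Λ j * ξ j) * v j ≤ ε * |v j| := by
      refine (le_abs_self _).trans ?_
      rw [abs_mul]
      exact mul_le_mul_of_nonneg_right (hopt j) (abs_nonneg _)
    have hscore : -(g j * v j) ≤ |g j| * |v j| := (neg_le_abs _).trans_eq (abs_mul _ _)
    linarith
  have hon : ∑ j ∈ supp βstar, -(Λ j * (ξ j * v j)) ≤ ∑ j ∈ supp βstar, Λ j * |v j| := by
    refine Finset.sum_le_sum fun j _ => ?_
    rw [← mul_neg]
    refine mul_le_mul_of_nonneg_left ((neg_le_abs _).trans ?_) (hΛ j)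
    rw [abs_mul]
    exact mul_le_of_le_one_left (abs_nonneg _) (abs_le_one_of_mem_subdifferential hξ j)
  have hoff : ∑ j ∈ (supp βstar)ᶜ, -(Λ j * (ξ j * v j)) = -∑ j ∈ (supp βstar)ᶜ, Λ j * |v j| := by
    rw [← Finset.sum_neg_distrib]
    refine Finset.sum_congr rfl fun j hj => ?_
    rw [hv, sub_apply_of_notMem_supp (Finset.mem_compl.1 hj), mul_eq_abs_of_mem_subdifferential hξ]
  have hsum : ‖scaledDesign X v‖ ^ 2 ≤
      ∑ j, (ε + |g j|) * |v j| + ∑ j, -(Λ j * (ξ j * v j)) := by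
    rw [hid, ← Finset.sum_add_distrib]
    exact Finset.sum_le_sum fun j _ => (hcoord j).trans_eq (sub_eq_add_neg _ _)
  rw [← Finset.sum_add_sum_compl (supp βstar) fun j => -(Λ j * (ξ j * v j)), hoff] at hsum
  linarith

theorem norm_sq_add_mul_sum_compl_le (hg : ∀ j, |score X e j| ≤ lam / 16) (hε₀ : 0 ≤ ε)
    (hε : ε ≤ 3 / 16 * lam) {E : Finset (Fin d)} (hSE : supp βstar ⊆ E) (hΛ : ∀ j, 0 ≤ Λ j)
    (hΛE : ∀ j ∉ E, lam / 2 ≤ Λ j) {ξ : EuclideanSpace ℝ (Fin d)}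
    (hξ : ξ ∈ subdifferential l1Norm β)
    (hopt : ∀ j, |gradient (quadLoss X (response X βstar e)) β j + Λ j * ξ j| ≤ ε) :
    ‖scaledDesign X (β - βstar)‖ ^ 2 + lam / 4 * ∑ j ∈ Eᶜ, |(β - βstar) j| ≤
      effectiveNoise (score X e) Λ ε (supp βstar) E * ‖restrict E (β - βstar)‖ := by
  have hbasic := norm_sq_add_sum_le hξ hΛ hopt
  set v := β - βstar
  have hnoise := sum_le_effectiveNoise_mul (g := score X e) (v := v) (Λ := Λ) hε₀ hSE
  have hpenalty : lam / 2 * ∑ j ∈ Eᶜ, |v j| ≤ ∑ j ∈ (supp βstar)ᶜ, Λ j * |v j| := by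
    rw [Finset.mul_sum]
    calc ∑ j ∈ Eᶜ, lam / 2 * |v j| ≤ ∑ j ∈ Eᶜ, Λ j * |v j| := Finset.sum_le_sum fun j hj =>
          mul_le_mul_of_nonneg_right (hΛE j (Finset.mem_compl.1 hj)) (abs_nonneg _)
      _ ≤ ∑ j ∈ (supp βstar)ᶜ, Λ j * |v j| :=
          Finset.sum_le_sum_of_subset_of_nonneg (Finset.compl_subset_compl.2 hSE) fun j _ _ =>
            mul_nonneg (hΛ j) (abs_nonneg _)
  have hcompl : ∑ j ∈ Eᶜ, (ε + |score X e j|) * |v j| ≤ lam / 4 * ∑ j ∈ Eᶜ, |v j| := by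
    rw [Finset.mul_sum]
    exact Finset.sum_le_sum fun j _ =>
      mul_le_mul_of_nonneg_right (by linarith [hg j]) (abs_nonneg _)
  rw [← Finset.sum_add_sum_compl E] at hbasic
  linarith

theorem IsEpsOptimal.mul_norm_sub_le (hRE : RestrictedEigenvalue (scaledDesign X)
    (supp βstar).card ρ) (hlam : 0 < lam) (hg : ∀ j, |score X e j| ≤ lam / 16) {ε' : ℝ}
    (hε' : ε' < ε) (hε₀ : 0 ≤ ε) (hε : ε ≤ 3 / 16 * lam) {E : Finset (Fin d)}
    (hSE : supp βstar ⊆ E) (hE : E.card ≤ 2 * (supp βstar).card) (hΛ : ∀ j, Λ j ∈ Set.Icc 0 lam)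
    (hΛE : ∀ j ∉ E, lam / 2 ≤ Λ j)
    (hopt : IsEpsOptimal (quadLoss X (response X βstar e)) Λ ε' β) :
    ρ * ‖β - βstar‖ ≤ 5 * effectiveNoise (score X e) Λ ε (supp βstar) E := by
  obtain ⟨ξ, hξ, hres⟩ := hopt.exists_subgradient hε'
  have hmain := norm_sq_add_mul_sum_compl_le hg hε₀ hε hSE (fun j => (hΛ j).1) hΛE hξ hres
  set v := β - βstar
  set a := effectiveNoise (score X e) Λ ε (supp βstar) E
  have ha : a * ‖restrict E v‖ ≤ 3 / 2 * lam * √(supp βstar).card * ‖restrict E v‖ := by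
    gcongr
    exact effectiveNoise_le hg hlam.le hε hΛ hE
  have hcone : ∑ j ∈ Eᶜ, |v j| ≤ 6 * √(supp βstar).card * ‖restrict E v‖ := by
    refine le_of_mul_le_mul_left ?_ (by positivity : 0 < lam / 4)
    linarith [sq_nonneg ‖scaledDesign X v‖]
  have hquad : ‖scaledDesign X v‖ ^ 2 ≤ a * ‖restrict E v‖ := by
    have : 0 ≤ lam / 4 * ∑ j ∈ Eᶜ, |v j| := by positivity
    linarith
  exact hRE.norm_le (effectiveNoise_nonneg _ hε₀ _ _) hE hcone hquad

theorem IsEpsOptimal.mul_norm_sub_le_contraction (hRE : RestrictedEigenvalue (scaledDesign X)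
    (supp βstar).card ρ) (hlam : 0 < lam) (hg : ∀ j, |score X e j| ≤ lam / 16) {εc : ℝ}
    (hεc : εc ≤ lam / 8) (hΛ : ∀ j, Λ j ∈ Set.Icc (lam / 2) lam)
    (hopt : IsEpsOptimal (quadLoss X (response X βstar e)) Λ εc β) :
    ρ * ‖β - βstar‖ ≤ 18 * lam * √(supp βstar).card := by
  have hΛ' (j : Fin d) : Λ j ∈ Set.Icc 0 lam := ⟨(by positivity : 0 ≤ lam / 2).trans (hΛ j).1,
    (hΛ j).2⟩
  have hcard : (supp βstar).card ≤ 2 * (supp βstar).card := by omega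
  have hstage := hopt.mul_norm_sub_le hRE hlam hg (ε := 3 / 16 * lam) (by linarith)
    (by positivity) le_rfl subset_rfl hcard hΛ' fun j _ => (hΛ j).1
  have hnoise := effectiveNoise_le hg hlam.le le_rfl hΛ' hcard
  linarith [mul_nonneg hlam.le (Real.sqrt_nonneg (supp βstar).card)]

end Stage

section Tightening

variable {d : ℕ} {βstar β : EuclideanSpace ℝ (Fin d)} {lam u τ : ℝ} {w : ℝ → ℝ}

theorem adaptiveWeights_mem_Icc (hw : IsTighteningFunction w) (hlam : 0 ≤ lam)
    (β : EuclideanSpace ℝ (Fin d)) (j : Fin d) : adaptiveWeights lam w β j ∈ Set.Icc 0 lam :=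
  ⟨mul_nonneg hlam (hw.nonneg _ (abs_nonneg _)),
    mul_le_of_le_one_right hlam (hw.le_one _ (abs_nonneg _))⟩

theorem half_le_adaptiveWeights (hw : IsTighteningFunction w) (hlam : 0 ≤ lam)
    (hwu : 1 / 2 ≤ w u) {j : Fin d} (hj : |β j| ≤ u) : lam / 2 ≤ adaptiveWeights lam w β j := by
  have h : 1 / 2 ≤ w |β j| := hwu.trans (hw.antitone u |β j| (abs_nonneg _) hj)
  calc lam / 2 = lam * (1 / 2) := by ring
    _ ≤ lam * w |β j| := by gcongr

/-- Either the estimate exceeds `τ` and its weight vanishes, or it misses at least `u` of the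
signal. -/
theorem mul_adaptiveWeights_le (hw : IsTighteningFunction w) (hlam : 0 ≤ lam) (hu : 0 ≤ u)
    (hτ : 0 ≤ τ) (hwτ : w τ = 0) {j : Fin d} (hj : u + τ ≤ |βstar j|) :
    u * adaptiveWeights lam w β j ≤ lam * |(β - βstar) j| := by
  rcases le_or_gt τ |β j| with hlarge | hsmall
  · have hw0 : w |β j| = 0 :=
      le_antisymm (hwτ ▸ hw.antitone _ _ hτ hlarge) (hw.nonneg _ (abs_nonneg _))
    rw [adaptiveWeights, hw0, mul_zero, mul_zero]
    positivity
  · have hmiss : u ≤ |(β - βstar) j| := by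
      have := abs_sub_abs_le_abs_sub (βstar j) (β j)
      rw [PiLp.sub_apply, abs_sub_comm]
      linarith
    rw [mul_comm]
    exact mul_le_mul (adaptiveWeights_mem_Icc hw hlam β j).2 hmiss hu hlam

theorem mul_norm_restrict_adaptiveWeights_le (hw : IsTighteningFunction w) (hlam : 0 ≤ lam)
    (hu : 0 ≤ u) (hτ : 0 ≤ τ) (hwτ : w τ = 0) (hsignal : ∀ j ∈ supp βstar, u + τ ≤ |βstar j|) :
    u * ‖restrict (supp βstar) (WithLp.toLp 2 (adaptiveWeights lam w β))‖ ≤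
      lam * ‖β - βstar‖ := by
  have hcoord : ∀ j ∈ supp βstar,
      |(u • WithLp.toLp 2 (adaptiveWeights lam w β)) j| ≤ |(lam • (β - βstar)) j| := by
    intro j hj
    rw [PiLp.smul_apply, PiLp.smul_apply, smul_eq_mul, smul_eq_mul, abs_mul, abs_mul,
      abs_of_nonneg hu, abs_of_nonneg hlam, abs_of_nonneg (adaptiveWeights_mem_Icc hw hlam β j).1]
    exact mul_adaptiveWeights_le hw hlam hu hτ hwτ (hsignal j hj)
  have h := norm_restrict_le_norm_restrict hcoord
  rw [restrict_smul, restrict_smul, norm_smul, norm_smul, Real.norm_of_nonneg hu,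
    Real.norm_of_nonneg hlam] at h
  exact h.trans (by gcongr; exact norm_restrict_le _ _)

/-- The coordinates outside the support of `βstar` at which `β` exceeds the threshold `u`, so that
the next stage may fail to penalize them. -/
noncomputable def falseDiscoveries (βstar β : EuclideanSpace ℝ (Fin d)) (u : ℝ) : Finset (Fin d) :=
  (supp βstar)ᶜ.filter fun j => u < |β j|

theorem disjoint_supp_falseDiscoveries : Disjoint (supp βstar) (falseDiscoveries βstar β u) :=
  disjoint_compl_right.mono_right (Finset.filter_subset _ _)

theorem abs_le_of_notMem_supp_union_falseDiscoveries {j : Fin d}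
    (hj : j ∉ supp βstar ∪ falseDiscoveries βstar β u) : |β j| ≤ u := by
  rw [Finset.mem_union, not_or] at hj
  by_contra! hlt
  exact hj.2 (Finset.mem_filter.2 ⟨Finset.mem_compl.2 hj.1, hlt⟩)

theorem mul_sqrt_card_falseDiscoveries_le (hu : 0 ≤ u) :
    u * √(falseDiscoveries βstar β u).card ≤ ‖β - βstar‖ := by
  refine (mul_sqrt_card_le_norm_restrict hu fun j hj => ?_).trans
    (norm_restrict_le (falseDiscoveries βstar β u) _)
  obtain ⟨hjS, hju⟩ := Finset.mem_filter.1 hj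
  rw [sub_apply_of_notMem_supp (Finset.mem_compl.1 hjS)]
  exact hju.le

theorem norm_restrict_union_le {J K : Finset (Fin d)} (h : Disjoint J K)
    (g : EuclideanSpace ℝ (Fin d)) : ‖restrict (J ∪ K) g‖ ≤ ‖restrict J g‖ + ‖restrict K g‖ := by
  rw [restrict_union h]
  exact norm_add_le _ _

variable {n : ℕ} {X : Matrix (Fin n) (Fin d) ℝ} {e : Fin n → ℝ} {ρ εt η : ℝ}
  {β' : EuclideanSpace ℝ (Fin d)}

theorem card_falseDiscoveries_le (hρ : 0 ≤ ρ) (hlam : 0 < lam) (hu : 0 ≤ u)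
    (hlamu : 18 * lam ≤ ρ * u) (hβ : ρ * ‖β - βstar‖ ≤ 18 * lam * √(supp βstar).card) :
    (falseDiscoveries βstar β u).card ≤ (supp βstar).card := by
  have h : 18 * lam * √(falseDiscoveries βstar β u).card ≤ 18 * lam * √(supp βstar).card :=
    calc 18 * lam * √(falseDiscoveries βstar β u).card
        ≤ ρ * u * √(falseDiscoveries βstar β u).card := by gcongr
      _ = ρ * (u * √(falseDiscoveries βstar β u).card) := by ring
      _ ≤ ρ * ‖β - βstar‖ := by gcongr; exact mul_sqrt_card_falseDiscoveries_le hu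
      _ ≤ 18 * lam * √(supp βstar).card := hβ
  exact_mod_cast (Real.sqrt_le_sqrt_iff (Nat.cast_nonneg _)).1
    (le_of_mul_le_mul_left h (by positivity))

/-- The false discoveries and the weights left on the support are both paid for by the error of
the previous iterate, with a factor small enough to make the iteration contract. -/
theorem effectiveNoise_adaptiveWeights_le (hρ : 0 ≤ ρ) (hlam : 0 < lam)
    (hg : ∀ j, |score X e j| ≤ lam / 16) (hw : IsTighteningFunction w) (hτ : 0 ≤ τ)
    (hwτ : w τ = 0) (hsignal : ∀ j ∈ supp βstar, u + τ ≤ |βstar j|) (hu : 0 ≤ u)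
    (hlamu : 18 * lam ≤ ρ * u) (hη : 0 ≤ η)
    (hcard : (supp βstar ∪ falseDiscoveries βstar β u).card ≤ 2 * (supp βstar).card) :
    5 * effectiveNoise (score X e) (adaptiveWeights lam w β) η (supp βstar)
        (supp βstar ∪ falseDiscoveries βstar β u) ≤
      5 * (‖restrict (supp βstar) (score X e)‖ + 3 / 2 * η * √(supp βstar).card) +
        1 / 2 * (ρ * ‖β - βstar‖) := by
  set S := supp βstar
  set F := falseDiscoveries βstar β u
  set Λ := WithLp.toLp 2 (adaptiveWeights lam w β)
  have hnoise : ‖restrict (S ∪ F) (score X e)‖ ≤ ‖restrict S (score X e)‖ + lam / 16 * √F.card :=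
    (norm_restrict_union_le disjoint_supp_falseDiscoveries _).trans <| by
      gcongr
      exact norm_restrict_le_mul_sqrt_card (by positivity) fun j _ => hg j
  have htol : η * √(S ∪ F).card ≤ η * (3 / 2 * √S.card) := by
    gcongr
    exact sqrt_card_le hcard
  have hfalse : 18 * lam * √F.card ≤ ρ * ‖β - βstar‖ :=
    calc 18 * lam * √F.card ≤ ρ * u * √F.card := by gcongr
      _ = ρ * (u * √F.card) := by ring
      _ ≤ ρ * ‖β - βstar‖ := by gcongr; exact mul_sqrt_card_falseDiscoveries_le hu
  have hweights : 18 * ‖restrict S Λ‖ ≤ ρ * ‖β - βstar‖ := by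
    refine le_of_mul_le_mul_left ?_ hlam
    calc lam * (18 * ‖restrict S Λ‖) = 18 * lam * ‖restrict S Λ‖ := by ring
      _ ≤ ρ * u * ‖restrict S Λ‖ := by gcongr
      _ = ρ * (u * ‖restrict S Λ‖) := by ring
      _ ≤ ρ * (lam * ‖β - βstar‖) := mul_le_mul_of_nonneg_left
          (mul_norm_restrict_adaptiveWeights_le hw hlam.le hu hτ hwτ hsignal) hρ
      _ = lam * (ρ * ‖β - βstar‖) := by ring
  have herr : 0 ≤ ρ * ‖β - βstar‖ := by positivity
  rw [effectiveNoise]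
  linarith

theorem IsEpsOptimal.mul_norm_sub_le_tightening (hRE : RestrictedEigenvalue (scaledDesign X)
    (supp βstar).card ρ) (hρ : 0 ≤ ρ) (hlam : 0 < lam) (hg : ∀ j, |score X e j| ≤ lam / 16)
    (hw : IsTighteningFunction w) (hwu : 1 / 2 ≤ w u) (hτ : 0 ≤ τ) (hwτ : w τ = 0)
    (hsignal : ∀ j ∈ supp βstar, u + τ ≤ |βstar j|) (hlamu : 18 * lam ≤ ρ * u)
    (hεt : εt < η) (hη₀ : 0 ≤ η) (hη : η ≤ 3 / 16 * lam)
    (hβ : ρ * ‖β - βstar‖ ≤ 18 * lam * √(supp βstar).card)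
    (hopt : IsEpsOptimal (quadLoss X (response X βstar e)) (adaptiveWeights lam w β) εt β') :
    ρ * ‖β' - βstar‖ ≤ 18 * lam * √(supp βstar).card ∧
      ρ * ‖β' - βstar‖ ≤
        5 * (‖restrict (supp βstar) (score X e)‖ + 3 / 2 * η * √(supp βstar).card) +
          1 / 2 * (ρ * ‖β - βstar‖) := by
  have hu : 0 ≤ u := (pos_of_mul_pos_right ((by positivity : 0 < 18 * lam).trans_le hlamu) hρ).le
  have hcard : (supp βstar ∪ falseDiscoveries βstar β u).card ≤ 2 * (supp βstar).card := by
    have := card_falseDiscoveries_le hρ hlam hu hlamu hβ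
    exact (Finset.card_union_le _ _).trans (by omega)
  have hΛ := adaptiveWeights_mem_Icc hw hlam.le β
  have hstage := hopt.mul_norm_sub_le hRE hlam hg hεt hη₀ hη Finset.subset_union_left hcard hΛ
    fun j hj => half_le_adaptiveWeights hw hlam.le hwu
      (abs_le_of_notMem_supp_union_falseDiscoveries hj)
  refine ⟨?_, hstage.trans
    (effectiveNoise_adaptiveWeights_le hρ hlam hg hw hτ hwτ hsignal hu hlamu hη₀ hcard)⟩
  linarith [effectiveNoise_le hg hlam.le hη hΛ hcard,
    mul_nonneg hlam.le (Real.sqrt_nonneg (supp βstar).card)]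

theorem IsTACSequence.mul_norm_sub_le (hRE : RestrictedEigenvalue (scaledDesign X)
    (supp βstar).card ρ) (hρ : 0 ≤ ρ) (hlam : 0 < lam) (hg : ∀ j, |score X e j| ≤ lam / 16)
    (hw : IsTighteningFunction w) (hwu : 1 / 2 ≤ w u) (hτ : 0 ≤ τ) (hwτ : w τ = 0)
    (hsignal : ∀ j ∈ supp βstar, u + τ ≤ |βstar j|) (hlamu : 18 * lam ≤ ρ * u) {εc : ℝ}
    (hεc : εc ≤ lam / 8) (hεt : εt < η) (hη₀ : 0 ≤ η) (hη : η ≤ 3 / 16 * lam) {Λ₀ : Fin d → ℝ}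
    (hΛ₀ : ∀ j, Λ₀ j ∈ Set.Icc (lam / 2) lam) {T : ℕ} (hT : 1 ≤ T)
    {b : ℕ → EuclideanSpace ℝ (Fin d)}
    (hb : IsTACSequence (quadLoss X (response X βstar e)) lam w Λ₀ εc εt T b) :
    ρ * ‖b T - βstar‖ ≤ (1 / 2) ^ T * (36 * lam * √(supp βstar).card) +
      10 * (‖restrict (supp βstar) (score X e)‖ + 3 / 2 * η * √(supp βstar).card) := by
  set N := ‖restrict (supp βstar) (score X e)‖ + 3 / 2 * η * √(supp βstar).card
  have hN : 0 ≤ N := by positivity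
  have hstages (ℓ : ℕ) (hℓ : 1 ≤ ℓ) : ℓ ≤ T →
      ρ * ‖b ℓ - βstar‖ ≤ 18 * lam * √(supp βstar).card ∧
        ρ * ‖b ℓ - βstar‖ ≤ (1 / 2) ^ ℓ * (36 * lam * √(supp βstar).card) + 10 * N := by
    induction ℓ, hℓ using Nat.le_induction with
    | base =>
      intro _
      have h := hb.contraction.mul_norm_sub_le_contraction hRE hlam hg hεc hΛ₀
      exact ⟨h, by linarith⟩
    | succ ℓ hℓ ih =>
      intro hℓT
      obtain ⟨hinv, herr⟩ := ih (by omega)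
      obtain ⟨hinv', herr' : _ ≤ 5 * N + _⟩ :=
        (hb.tightening ℓ hℓ (by omega)).mul_norm_sub_le_tightening hRE hρ hlam hg hw hwu hτ hwτ
          hsignal hlamu hεt hη₀ hη hinv
      refine ⟨hinv', ?_⟩
      rw [pow_succ]
      linarith
  exact (hstages T hT le_rfl).2

theorem half_pow_mul_sqrt_log_le_one {x : ℝ} (hx : 0 < Real.log x) {T : ℕ}
    (hT : Real.log (Real.log x) ≤ T) : (1 / 2 : ℝ) ^ T * √(Real.log x) ≤ 1 := by
  have hpow : √(Real.log x) ≤ 2 ^ T := by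
    rw [← Real.log_le_log_iff (Real.sqrt_pos.2 hx) (by positivity), Real.log_sqrt hx.le,
      Real.log_pow]
    linarith [mul_le_mul_of_nonneg_left Real.log_two_gt_d9.le (Nat.cast_nonneg (α := ℝ) T),
      (Nat.cast_nonneg T : (0 : ℝ) ≤ T)]
  calc (1 / 2 : ℝ) ^ T * √(Real.log x) ≤ (1 / 2) ^ T * 2 ^ T := by gcongr
    _ = 1 := by rw [← mul_pow]; norm_num

end Tightening

section Noise

open scoped NNReal ENNReal Matrix

theorem lintegral_pi_prod_ofReal {ι : Type*} [Fintype ι] {ν : Measure ℝ} [SigmaFinite ν]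
    {f : ι → ℝ → ℝ} (hf : ∀ j z, 0 ≤ f j z) (hint : ∀ j, Integrable (f j) ν) :
    ∫⁻ z : ι → ℝ, ENNReal.ofReal (∏ j, f j (z j)) ∂Measure.pi (fun _ => ν) =
      ENNReal.ofReal (∏ j, ∫ z, f j z ∂ν) := by
  rw [← ofReal_integral_eq_lintegral_ofReal (Integrable.fintype_prod hint)
    (ae_of_all _ fun z => Finset.prod_nonneg fun j _ => hf j _), integral_fintype_prod_eq_prod]

theorem gaussianPDFReal_mul_exp_sq_div_four (z : ℝ) :
    gaussianPDFReal 0 1 z * Real.exp (z ^ 2 / 4) = √2 * gaussianPDFReal 0 2 z := by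
  have hexp : Real.exp (-z ^ 2 / 2) * Real.exp (z ^ 2 / 4) = Real.exp (-z ^ 2 / (2 * 2)) := by
    rw [← Real.exp_add]
    congr 1
    ring
  have hnorm : √(2 * Real.pi * 2) = √(2 * Real.pi) * √2 := Real.sqrt_mul (by positivity) _
  simp only [gaussianPDFReal, NNReal.coe_one, NNReal.coe_ofNat, sub_zero, mul_one]
  rw [mul_assoc, hexp, hnorm]
  field_simp

theorem integrable_exp_sq_div_four_gaussianReal :
    Integrable (fun z : ℝ => Real.exp (z ^ 2 / 4)) (gaussianReal 0 1) := by
  rw [gaussianReal_of_var_ne_zero 0 one_ne_zero,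
    integrable_withDensity_iff_integrable_smul' (measurable_gaussianPDF 0 1)
      (ae_of_all _ fun _ => gaussianPDF_lt_top)]
  simp only [toReal_gaussianPDF, smul_eq_mul, gaussianPDFReal_mul_exp_sq_div_four]
  exact (integrable_gaussianPDFReal 0 2).const_mul _

theorem integral_exp_sq_div_four_gaussianReal :
    ∫ z : ℝ, Real.exp (z ^ 2 / 4) ∂gaussianReal 0 1 = √2 := by
  rw [integral_gaussianReal_eq_integral_smul one_ne_zero]
  simp only [smul_eq_mul, gaussianPDFReal_mul_exp_sq_div_four]
  rw [integral_const_mul, integral_gaussianPDFReal_eq_one 0 two_ne_zero, mul_one]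

variable {Ω : Type*} [MeasurableSpace Ω] {μ : Measure Ω} {κ ι : Type*} [Fintype κ]
  {c : ℝ≥0} {e : κ → Ω → ℝ}

theorem aemeasurable_vecMul [Countable ι] (hmeas : ∀ i, AEMeasurable (e i) μ)
    (B : Matrix κ ι ℝ) : AEMeasurable (fun ω => (fun i => e i ω) ᵥ* B) μ :=
  aemeasurable_pi_lambda _ fun _ =>
    Finset.aemeasurable_fun_sum _ fun i _ => (hmeas i).mul_const _

variable [Fintype ι]

theorem lintegral_exp_dotProduct_gaussian (a : ι → ℝ) :
    ∫⁻ z : ι → ℝ, ENNReal.ofReal (Real.exp (a ⬝ᵥ z)) ∂Measure.pi (fun _ => gaussianReal 0 1) =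
      ENNReal.ofReal (Real.exp (a ⬝ᵥ a / 2)) := by
  have hmgf (t : ℝ) : ∫ z, Real.exp (t * z) ∂gaussianReal 0 1 = Real.exp (t ^ 2 / 2) := by
    simpa [mgf] using congrFun (mgf_fun_id_gaussianReal (μ := 0) (v := 1)) t
  have h := lintegral_pi_prod_ofReal (ν := gaussianReal 0 1) (f := fun j z => Real.exp (a j * z))
    (fun _ _ => (Real.exp_pos _).le) fun j => integrable_exp_mul_gaussianReal (a j)
  simp only [hmgf, ← Real.exp_sum, ← Finset.sum_div] at h
  simpa only [dotProduct, ← sq] using h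

theorem lintegral_exp_dotProduct_self_div_four_gaussian :
    ∫⁻ z : ι → ℝ, ENNReal.ofReal (Real.exp (z ⬝ᵥ z / 4)) ∂Measure.pi (fun _ => gaussianReal 0 1) =
      ENNReal.ofReal (√2 ^ Fintype.card ι) := by
  have h := lintegral_pi_prod_ofReal (ι := ι) (f := fun _ z => Real.exp (z ^ 2 / 4))
    (fun _ _ => (Real.exp_pos _).le) fun _ => integrable_exp_sq_div_four_gaussianReal
  simp only [integral_exp_sq_div_four_gaussianReal, ← Real.exp_sum, ← Finset.sum_div,
    Finset.prod_const, Finset.card_univ] at h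
  simpa only [dotProduct, ← sq] using h

theorem hasSubgaussianMGF_dotProduct (hind : iIndepFun e μ)
    (hsub : ∀ i, HasSubgaussianMGF (e i) c μ) {b : κ → ℝ} {v : ℝ≥0} (hv : c * (b ⬝ᵥ b) ≤ v) :
    HasSubgaussianMGF (fun ω => b ⬝ᵥ fun i => e i ω) v μ := by
  have hterm (i : κ) : HasSubgaussianMGF (fun ω => b i * e i ω) ((b i ^ 2).toNNReal * c) μ := by
    rw [Real.toNNReal_of_nonneg (sq_nonneg _)]
    exact (hsub i).const_mul (b i)
  have h := HasSubgaussianMGF.sum_of_iIndepFun (s := Finset.univ)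
    (hind.comp (fun i x => b i * x) fun i => measurable_const_mul (b i)) fun i _ => hterm i
  have hproxy : ((∑ i, (b i ^ 2).toNNReal * c : ℝ≥0) : ℝ) = c * (b ⬝ᵥ b) := by
    rw [← Finset.sum_mul, mul_comm, NNReal.coe_mul, NNReal.coe_sum]
    simp only [fun i => Real.coe_toNNReal _ (sq_nonneg (b i)), dotProduct, ← sq]
  refine ⟨h.integrable_exp_mul, fun t => (h.mgf_le t).trans ?_⟩
  rw [hproxy]
  gcongr

theorem measureReal_le_abs_dotProduct_le (hind : iIndepFun e μ)
    (hsub : ∀ i, HasSubgaussianMGF (e i) c μ) {b : κ → ℝ} {v : ℝ≥0} (hv : c * (b ⬝ᵥ b) ≤ v)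
    {t : ℝ} (ht : 0 ≤ t) :
    μ.real {ω | t ≤ |b ⬝ᵥ fun i => e i ω|} ≤ 2 * Real.exp (-t ^ 2 / (2 * v)) := by
  have h := hasSubgaussianMGF_dotProduct hind hsub hv
  have hset : {ω | t ≤ |b ⬝ᵥ fun i => e i ω|} = {ω | t ≤ b ⬝ᵥ fun i => e i ω} ∪
      {ω | t ≤ (-fun ω => b ⬝ᵥ fun i => e i ω) ω} := by
    ext ω
    exact le_abs (a := t) (b := b ⬝ᵥ fun i => e i ω)
  rw [hset, two_mul]
  exact (measureReal_union_le _ _).trans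
    (add_le_add (h.measure_ge_le ht) (h.neg.measure_ge_le ht))

theorem lintegral_exp_dotProduct_le (hind : iIndepFun e μ)
    (hsub : ∀ i, HasSubgaussianMGF (e i) c μ) (b : κ → ℝ) :
    ∫⁻ ω, ENNReal.ofReal (Real.exp (b ⬝ᵥ fun i => e i ω)) ∂μ ≤
      ENNReal.ofReal (Real.exp (c * (b ⬝ᵥ b) / 2)) := by
  have hb : 0 ≤ c * (b ⬝ᵥ b) :=
    mul_nonneg c.2 (Finset.sum_nonneg fun i _ => mul_self_nonneg (b i))
  have h := hasSubgaussianMGF_dotProduct hind hsub (Real.le_coe_toNNReal (c * (b ⬝ᵥ b)))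
  have hint := h.integrable_exp_mul 1
  have hle := h.mgf_le 1
  simp only [mgf, one_mul, Real.coe_toNNReal _ hb, one_pow, mul_one] at hint hle
  rw [← ofReal_integral_eq_lintegral_ofReal hint (ae_of_all _ fun _ => (Real.exp_pos _).le)]
  exact ENNReal.ofReal_le_ofReal hle

theorem measureReal_le_exp_neg_of_lintegral_exp_le {f : Ω → ℝ} (hf : AEMeasurable f μ) {k : ℕ}
    (h : ∫⁻ ω, ENNReal.ofReal (Real.exp (f ω / 2)) ∂μ ≤ ENNReal.ofReal (√2 ^ k)) :
    μ.real {ω | 4 * (k : ℝ) ≤ f ω} ≤ Real.exp (-k) := by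
  have hset : {ω | 4 * (k : ℝ) ≤ f ω} = {ω | ENNReal.ofReal (Real.exp (2 * k)) ≤
      ENNReal.ofReal (Real.exp (f ω / 2))} := by
    ext ω
    rw [Set.mem_ofPred_eq, Set.mem_ofPred_eq, ENNReal.ofReal_le_ofReal_iff (Real.exp_pos _).le,
      Real.exp_le_exp, le_div_iff₀ two_pos]
    ring_nf
  have hmarkov : Real.exp (2 * k) * μ.real {ω | 4 * (k : ℝ) ≤ f ω} ≤ √2 ^ k := by
    have h' := (mul_meas_ge_le_lintegral₀ (hf.div_const 2).exp.ennreal_ofReal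
      (ENNReal.ofReal (Real.exp (2 * k)))).trans h
    rw [← hset] at h'
    have := ENNReal.toReal_mono ENNReal.ofReal_ne_top h'
    rwa [ENNReal.toReal_mul, ENNReal.toReal_ofReal (Real.exp_pos _).le,
      ENNReal.toReal_ofReal (by positivity)] at this
  have hsqrt : √2 ^ k ≤ Real.exp k := by
    have : √2 ≤ Real.exp 1 := by
      linarith [Real.add_one_le_exp (1 : ℝ), Real.sqrt_two_lt_three_halves]
    calc √2 ^ k ≤ Real.exp 1 ^ k := by gcongr
      _ = Real.exp k := by rw [← Real.exp_nat_mul, mul_one]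
  refine le_of_mul_le_mul_left (hmarkov.trans (hsqrt.trans_eq ?_)) (Real.exp_pos (2 * (k : ℝ)))
  rw [← Real.exp_add]
  congr 1
  ring

variable [IsProbabilityMeasure μ]

/-- A Gaussian vector `z` independent of the noise linearizes the quadratic form, as
`exp (‖Bᵀe‖² / 2)` is the mean of `exp ⟪Bᵀe, z⟫ = exp ⟪e, B z⟫`. -/
theorem lintegral_exp_quadratic_le (hind : iIndepFun e μ)
    (hsub : ∀ i, HasSubgaussianMGF (e i) c μ) (B : Matrix κ ι ℝ)
    (hB : ∀ z, c * (B *ᵥ z ⬝ᵥ B *ᵥ z) ≤ z ⬝ᵥ z / 2) :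
    ∫⁻ ω, ENNReal.ofReal (Real.exp
        (((fun i => e i ω) ᵥ* B) ⬝ᵥ ((fun i => e i ω) ᵥ* B) / 2)) ∂μ ≤
      ENNReal.ofReal (√2 ^ Fintype.card ι) := by
  set γ : Measure (ι → ℝ) := Measure.pi fun _ => gaussianReal 0 1
  have hmeas : AEMeasurable (fun p : Ω × (ι → ℝ) =>
      ENNReal.ofReal (Real.exp (((fun i => e i p.1) ᵥ* B) ⬝ᵥ p.2))) (μ.prod γ) := by
    have hfst := aemeasurable_vecMul (fun i => (hsub i).aemeasurable.comp_fst (ν := γ)) B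
    refine (Real.measurable_exp.comp_aemeasurable ?_).ennreal_ofReal
    exact Finset.aemeasurable_fun_sum _ fun j _ =>
      (aemeasurable_pi_iff.1 hfst j).mul (by fun_prop)
  calc ∫⁻ ω, ENNReal.ofReal (Real.exp
        (((fun i => e i ω) ᵥ* B) ⬝ᵥ ((fun i => e i ω) ᵥ* B) / 2)) ∂μ
      = ∫⁻ ω, ∫⁻ z, ENNReal.ofReal (Real.exp (((fun i => e i ω) ᵥ* B) ⬝ᵥ z)) ∂γ ∂μ := by
        simp only [γ, lintegral_exp_dotProduct_gaussian]
    _ = ∫⁻ z, ∫⁻ ω, ENNReal.ofReal (Real.exp (B *ᵥ z ⬝ᵥ fun i => e i ω)) ∂μ ∂γ := by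
        rw [lintegral_lintegral_swap hmeas]
        simp only [← Matrix.dotProduct_mulVec, dotProduct_comm (B *ᵥ _)]
    _ ≤ ∫⁻ z, ENNReal.ofReal (Real.exp (z ⬝ᵥ z / 4)) ∂γ := by
        refine lintegral_mono fun z => (lintegral_exp_dotProduct_le hind hsub _).trans ?_
        refine ENNReal.ofReal_le_ofReal (Real.exp_le_exp.2 ?_)
        linarith [hB z]
    _ = ENNReal.ofReal (√2 ^ Fintype.card ι) := lintegral_exp_dotProduct_self_div_four_gaussian

theorem measureReal_card_le_quadratic_le (hind : iIndepFun e μ)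
    (hsub : ∀ i, HasSubgaussianMGF (e i) c μ) (B : Matrix κ ι ℝ) {τ : ℝ} (hτ : 0 < τ)
    (hB : ∀ z, c * (B *ᵥ z ⬝ᵥ B *ᵥ z) ≤ τ * (z ⬝ᵥ z)) :
    μ.real {ω | 8 * τ * Fintype.card ι ≤
        ((fun i => e i ω) ᵥ* B) ⬝ᵥ ((fun i => e i ω) ᵥ* B)} ≤
      Real.exp (-Fintype.card ι) := by
  set α := (√(2 * τ))⁻¹
  have hα : α * α = (2 * τ)⁻¹ := by rw [← mul_inv, Real.mul_self_sqrt (by positivity)]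
  have hαB (z : ι → ℝ) : c * ((α • B) *ᵥ z ⬝ᵥ (α • B) *ᵥ z) ≤ z ⬝ᵥ z / 2 := by
    rw [Matrix.smul_mulVec, smul_dotProduct, dotProduct_smul, smul_smul, hα, smul_eq_mul]
    calc c * ((2 * τ)⁻¹ * (B *ᵥ z ⬝ᵥ B *ᵥ z)) = (2 * τ)⁻¹ * (c * (B *ᵥ z ⬝ᵥ B *ᵥ z)) := by ring
      _ ≤ (2 * τ)⁻¹ * (τ * (z ⬝ᵥ z)) := mul_le_mul_of_nonneg_left (hB z) (by positivity)
      _ = z ⬝ᵥ z / 2 := by field_simp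
  have hmeas := aemeasurable_vecMul (fun i => (hsub i).aemeasurable) (α • B)
  have htail := measureReal_le_exp_neg_of_lintegral_exp_le
    (Finset.aemeasurable_fun_sum _ fun j _ =>
      (aemeasurable_pi_iff.1 hmeas j).mul (aemeasurable_pi_iff.1 hmeas j))
    (lintegral_exp_quadratic_le hind hsub (α • B) hαB)
  convert htail using 4 with ω
  change _ ↔ _ ≤ ((fun i => e i ω) ᵥ* (α • B)) ⬝ᵥ ((fun i => e i ω) ᵥ* (α • B))
  rw [Matrix.vecMul_smul, smul_dotProduct, dotProduct_smul, smul_smul, hα, smul_eq_mul,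
    ← div_eq_inv_mul, le_div_iff₀ (by positivity)]
  ring_nf

end Noise

section Score

open scoped NNReal Matrix

variable {n d : ℕ} {X : Matrix (Fin n) (Fin d) ℝ}

theorem score_apply (e : Fin n → ℝ) (j : Fin d) :
    score X e j = (-(n : ℝ)⁻¹ • X.col j) ⬝ᵥ e := by
  rw [score, neg_smul, neg_dotProduct, smul_dotProduct, dotProduct_comm]
  rfl

theorem norm_scaledDesign_sq (v : EuclideanSpace ℝ (Fin d)) :
    ‖scaledDesign X v‖ ^ 2 = (n : ℝ)⁻¹ * (X *ᵥ v ⬝ᵥ X *ᵥ v) := by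
  rw [← real_inner_self_eq_norm_sq, inner_scaledDesign, EuclideanSpace.inner_eq_star_dotProduct]
  rfl

theorem submatrix_mulVec (S : Finset (Fin d)) (z : S → ℝ) :
    X.submatrix id Subtype.val *ᵥ z =
      X *ᵥ restrict S (WithLp.toLp 2 (Function.extend Subtype.val z 0)) := by
  ext i
  simp only [Matrix.mulVec, dotProduct, restrict_apply, mul_ite, mul_zero, Finset.sum_ite_mem,
    Finset.univ_inter]
  rw [← Finset.sum_coe_sort S]
  simp

theorem norm_restrict_extend_sq (S : Finset (Fin d)) (z : S → ℝ) :
    ‖restrict S (WithLp.toLp 2 (Function.extend Subtype.val z 0))‖ ^ 2 = z ⬝ᵥ z := by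
  rw [norm_restrict_sq, ← Finset.sum_coe_sort S]
  simp [dotProduct, sq]

theorem norm_restrict_score_sq (S : Finset (Fin d)) (e : Fin n → ℝ) :
    ‖restrict S (score X e)‖ ^ 2 =
      e ᵥ* ((n : ℝ)⁻¹ • X.submatrix id (Subtype.val : S → Fin d)) ⬝ᵥ
        e ᵥ* ((n : ℝ)⁻¹ • X.submatrix id Subtype.val) := by
  rw [norm_restrict_sq, ← Finset.sum_coe_sort S, Matrix.vecMul_smul]
  exact Finset.sum_congr rfl fun j _ => by
    rw [sq, score, PiLp.toLp_apply, Pi.neg_apply, neg_mul_neg]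
    rfl

variable {Ω : Type*} [MeasurableSpace Ω] {μ : Measure Ω} {e : Fin n → Ω → ℝ} {c : ℝ≥0}

theorem measureReal_exists_le_abs_score_le (hind : iIndepFun e μ)
    (hsub : ∀ i, HasSubgaussianMGF (e i) c μ)
    (hX : ∀ j, ‖(WithLp.toLp 2 (fun i => X i j) : EuclideanSpace ℝ (Fin n))‖ ≤ √n)
    {t : ℝ} (ht : 0 ≤ t) :
    μ.real {ω | ∃ j, t ≤ |score X (fun i => e i ω) j|} ≤
      d * (2 * Real.exp (-t ^ 2 / (2 * (c / n)))) := by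
  have hcol (j : Fin d) :
      c * ((-(n : ℝ)⁻¹ • X.col j) ⬝ᵥ (-(n : ℝ)⁻¹ • X.col j)) ≤ ((c / n : ℝ≥0) : ℝ) := by
    have hnorm : X.col j ⬝ᵥ X.col j ≤ n := by
      have := pow_le_pow_left₀ (norm_nonneg _) (hX j) 2
      rwa [Real.sq_sqrt n.cast_nonneg, ← real_inner_self_eq_norm_sq,
        EuclideanSpace.inner_eq_star_dotProduct] at this
    rw [smul_dotProduct, dotProduct_smul, smul_smul, neg_mul_neg, smul_eq_mul, NNReal.coe_div,
      NNReal.coe_natCast, div_eq_mul_inv]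
    gcongr
    calc (n : ℝ)⁻¹ * (n : ℝ)⁻¹ * (X.col j ⬝ᵥ X.col j) ≤ (n : ℝ)⁻¹ * (n : ℝ)⁻¹ * n := by gcongr
      _ = (n : ℝ)⁻¹ := by simpa using mul_self_mul_inv (n : ℝ)⁻¹
  have hset : {ω | ∃ j, t ≤ |score X (fun i => e i ω) j|} =
      ⋃ j, {ω | t ≤ |(-(n : ℝ)⁻¹ • X.col j) ⬝ᵥ fun i => e i ω|} := by
    simp only [score_apply, Set.ofPred_exists]
  rw [hset]
  refine (measureReal_iUnion_fintype_le _).trans ?_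
  refine (Finset.sum_le_card_nsmul _ _ _ fun j _ =>
    measureReal_le_abs_dotProduct_le hind hsub (hcol j) ht).trans_eq ?_
  rw [nsmul_eq_mul, Finset.card_univ, Fintype.card_fin, NNReal.coe_div, NNReal.coe_natCast]

theorem measureReal_le_norm_restrict_score_le [IsProbabilityMeasure μ] (hn : 0 < n) (hc : 0 < c)
    (hind : iIndepFun e μ) (hsub : ∀ i, HasSubgaussianMGF (e i) c μ) {S : Finset (Fin d)} {ρ : ℝ}
    (hρ : 0 < ρ) (hA : SparseUpperBound (scaledDesign X) S.card ρ) :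
    μ.real {ω | √(8 * c * ρ) * √(S.card / n) ≤ ‖restrict S (score X fun i => e i ω)‖} ≤
      Real.exp (-S.card) := by
  have hn' : (0 : ℝ) < n := by exact_mod_cast hn
  have hc' : (0 : ℝ) < c := hc
  set B := (n : ℝ)⁻¹ • X.submatrix id (Subtype.val : S → Fin d)
  have hB (z : S → ℝ) : c * (B *ᵥ z ⬝ᵥ B *ᵥ z) ≤ c * ρ / n * (z ⬝ᵥ z) := by
    have hz := hA S (WithLp.toLp 2 (Function.extend Subtype.val z 0)) le_rfl
    rw [norm_scaledDesign_sq, norm_restrict_extend_sq, ← submatrix_mulVec] at hz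
    rw [Matrix.smul_mulVec, smul_dotProduct, dotProduct_smul, smul_eq_mul, smul_eq_mul]
    calc c * ((n : ℝ)⁻¹ * ((n : ℝ)⁻¹ *
          (X.submatrix id Subtype.val *ᵥ z ⬝ᵥ X.submatrix id Subtype.val *ᵥ z)))
        ≤ c * ((n : ℝ)⁻¹ * (ρ * (z ⬝ᵥ z))) := by gcongr
      _ = c * ρ / n * (z ⬝ᵥ z) := by ring
  have htail := measureReal_card_le_quadratic_le hind hsub B (div_pos (mul_pos hc' hρ) hn') hB
  rw [Fintype.card_coe] at htail
  convert htail using 4 with ω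
  rw [← norm_restrict_score_sq, ← Real.sqrt_mul (by positivity),
    Real.sqrt_le_left (norm_nonneg _)]
  ring_nf

end Score

section StatisticalRate

open scoped NNReal

variable {n d : ℕ} {X : Matrix (Fin n) (Fin d) ℝ} {βstar : EuclideanSpace ℝ (Fin d)}
  {w : ℝ → ℝ} {lam u τ ρlo c₂ εc εt : ℝ} {Λ₀ : Fin d → ℝ} {T : ℕ}

theorem measureReal_exists_le_abs_score_le_rpow {Ω : Type*} [MeasurableSpace Ω] {μ : Measure Ω}
    {e : Fin n → Ω → ℝ} {c : ℝ≥0} (hn : 0 < n) (hd : 0 < d) (hc : 0 < c) (hind : iIndepFun e μ)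
    (hsub : ∀ i, HasSubgaussianMGF (e i) c μ)
    (hX : ∀ j, ‖(WithLp.toLp 2 (fun i => X i j) : EuclideanSpace ℝ (Fin n))‖ ≤ √n)
    {t : ℝ} (ht : 0 ≤ t) (hct : 4 * c * (Real.log d / n) ≤ t ^ 2) :
    μ.real {ω | ∃ j, t ≤ |score X (fun i => e i ω) j|} ≤ 2 * (d : ℝ) ^ (-1 : ℝ) := by
  have hn' : (0 : ℝ) < n := by exact_mod_cast hn
  have hd' : (0 : ℝ) < d := by exact_mod_cast hd
  have hc' : (0 : ℝ) < c := hc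
  have hexp : Real.exp (-t ^ 2 / (2 * (c / n))) ≤ (d : ℝ) ^ (-2 : ℝ) := by
    rw [Real.rpow_def_of_pos hd', Real.exp_le_exp,
      div_le_iff₀ (mul_pos two_pos (div_pos hc' hn'))]
    calc -t ^ 2 ≤ -(4 * c * (Real.log d / n)) := neg_le_neg hct
      _ = Real.log d * -2 * (2 * (c / n)) := by ring
  calc μ.real {ω | ∃ j, t ≤ |score X (fun i => e i ω) j|}
      ≤ d * (2 * Real.exp (-t ^ 2 / (2 * (c / n)))) :=
        measureReal_exists_le_abs_score_le hind hsub hX ht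
    _ ≤ d * (2 * (d : ℝ) ^ (-2 : ℝ)) := by gcongr
    _ = 2 * (d : ℝ) ^ (-1 : ℝ) := by
      rw [mul_left_comm, ← Real.rpow_one_add' hd'.le (by norm_num)]
      norm_num

theorem exists_measurableSet_score_le {Ω : Type*} [MeasurableSpace Ω] {μ : Measure Ω}
    [IsProbabilityMeasure μ] {e : Fin n → Ω → ℝ} {c : ℝ≥0} (hn : 0 < n) (hd : 0 < d) (hc : 0 < c)
    (hind : iIndepFun e μ) (hsub : ∀ i, HasSubgaussianMGF (e i) c μ)
    (hX : ∀ j, ‖(WithLp.toLp 2 (fun i => X i j) : EuclideanSpace ℝ (Fin n))‖ ≤ √n)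
    {t : ℝ} (ht : 0 ≤ t) (hct : 4 * c * (Real.log d / n) ≤ t ^ 2)
    {S : Finset (Fin d)} {ρ : ℝ} (hρ : 0 < ρ)
    (hA : SparseUpperBound (scaledDesign X) S.card ρ) :
    ∃ A, MeasurableSet A ∧ 1 - 2 * (d : ℝ) ^ (-1 : ℝ) - Real.exp (-S.card) ≤ μ.real A ∧
      ∀ ω ∈ A, (∀ j, |score X (fun i => e i ω) j| ≤ t) ∧
        ‖restrict S (score X fun i => e i ω)‖ ≤ √(8 * c * ρ) * √(S.card / n) := by
  set G := {ω | ∃ j, t ≤ |score X (fun i => e i ω) j|}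
  set Q := {ω | √(8 * c * ρ) * √(S.card / n) ≤ ‖restrict S (score X fun i => e i ω)‖}
  refine ⟨(toMeasurable μ (G ∪ Q))ᶜ, (measurableSet_toMeasurable μ _).compl, ?_, fun ω hω => ?_⟩
  · have hG : μ.real G ≤ 2 * (d : ℝ) ^ (-1 : ℝ) :=
      measureReal_exists_le_abs_score_le_rpow hn hd hc hind hsub hX ht hct
    have hQ : μ.real Q ≤ Real.exp (-S.card) :=
      measureReal_le_norm_restrict_score_le hn hc hind hsub hρ hA
    rw [probReal_compl_eq_one_sub (measurableSet_toMeasurable μ _), measureReal_def,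
      measure_toMeasurable, ← measureReal_def]
    linarith [measureReal_union_le (μ := μ) G Q]
  · have hGQ : ω ∉ G ∪ Q := fun h => hω (subset_toMeasurable μ _ h)
    obtain ⟨hG, hQ⟩ := not_or.1 hGQ
    exact ⟨fun j => le_of_not_ge fun hj => hG ⟨j, hj⟩, le_of_not_ge hQ⟩

theorem sqrt_one_div_le_two_mul_sqrt_log_div (hd : 2 ≤ d) :
    √(1 / n) ≤ 2 * √(Real.log d / n) := by
  have hlog : 1 / 4 ≤ Real.log d := by
    have := Real.log_le_log two_pos (by exact_mod_cast hd : (2 : ℝ) ≤ d)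
    linarith [Real.log_two_gt_d9]
  calc √(1 / n) ≤ √(2 ^ 2 * (Real.log d / n)) := by
        gcongr
        rw [← mul_div_assoc]
        gcongr
        linarith
    _ = 2 * √(Real.log d / n) := by
      rw [Real.sqrt_mul (by positivity), Real.sqrt_sq two_pos.le]

theorem half_pow_mul_sqrt_log_div_le (hd : 2 ≤ d) (hT : Real.log (Real.log d) ≤ T) :
    (1 / 2) ^ T * √(Real.log d / n) ≤ √(1 / n) := by
  have hlog : 0 < Real.log d := Real.log_pos (by exact_mod_cast hd)
  calc (1 / 2) ^ T * √(Real.log d / n)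
      = (1 / 2) ^ T * √(Real.log d) * √(1 / n) := by
        rw [div_eq_mul_one_div (Real.log d), Real.sqrt_mul hlog.le, mul_assoc]
    _ ≤ 1 * √(1 / n) := by
      gcongr
      exact half_pow_mul_sqrt_log_le_one hlog hT
    _ = √(1 / n) := one_mul _

theorem IsTACSequence.norm_sub_le {e : Fin n → ℝ} {κ : ℝ} (hn : 0 < n) (hd : 2 ≤ d)
    (hRE : RestrictedEigenvalue (scaledDesign X) (supp βstar).card ρlo) (hρlo : 0 < ρlo)
    (hw : IsTighteningFunction w) (hwu : 1 / 2 ≤ w u) (hτ : 0 ≤ τ) (hwτ : w τ = 0)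
    (hsignal : ∀ j ∈ supp βstar, u + τ ≤ |βstar j|) (hlamu : 18 * lam ≤ ρlo * u)
    (hlam : 32 * √(Real.log d / n) ≤ lam) (hlam' : lam ≤ c₂ * √(Real.log d / n))
    (hεc : εc ≤ lam / 8) (hεt : εt ≤ √(1 / n)) (hΛ₀ : ∀ j, Λ₀ j ∈ Set.Icc (lam / 2) lam)
    (hT : 1 ≤ T) (hT' : Real.log (Real.log d) ≤ T)
    (hscore : ∀ j, |score X e j| ≤ lam / 16)
    (hscore' : ‖restrict (supp βstar) (score X e)‖ ≤ κ * √((supp βstar).card / n))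
    {b : ℕ → EuclideanSpace ℝ (Fin d)}
    (hb : IsTACSequence (quadLoss X (response X βstar e)) lam w Λ₀ εc εt T b) :
    ‖b T - βstar‖ ≤ ρlo⁻¹ * (36 * c₂ + 10 * κ + 30) * √((supp βstar).card / n) := by
  set s := (supp βstar).card
  have hn' : 0 < √(1 / n : ℝ) := by positivity
  have hlog := sqrt_one_div_le_two_mul_sqrt_log_div (n := n) hd
  have hs : √(1 / n) * √s = √(s / n) := by
    rw [← Real.sqrt_mul (by positivity), one_div_mul_eq_div]
  have hc₂ : 0 ≤ c₂ := by
    refine (pos_of_mul_pos_left ?_ (Real.sqrt_nonneg (Real.log d / n))).le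
    linarith
  have hmain := hb.mul_norm_sub_le hRE hρlo.le (by linarith) hscore hw hwu hτ hwτ hsignal hlamu
    hεc (η := 2 * √(1 / n)) (by linarith) (by positivity) (by linarith) hΛ₀ hT
  have hiter : (1 / 2) ^ T * lam ≤ c₂ * √(1 / n) :=
    calc (1 / 2) ^ T * lam ≤ (1 / 2) ^ T * (c₂ * √(Real.log d / n)) := by gcongr
      _ = c₂ * ((1 / 2) ^ T * √(Real.log d / n)) := mul_left_comm _ _ _
      _ ≤ c₂ * √(1 / n) := by gcongr; exact half_pow_mul_sqrt_log_div_le hd hT'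
  rw [mul_assoc, le_inv_mul_iff₀ hρlo]
  calc ρlo * ‖b T - βstar‖
      ≤ 36 * ((1 / 2) ^ T * lam) * √s +
          10 * (‖restrict (supp βstar) (score X e)‖ + 3 * (√(1 / n) * √s)) := by linarith
    _ ≤ 36 * (c₂ * √(1 / n)) * √s + 10 * (κ * √(s / n) + 3 * (√(1 / n) * √s)) := by gcongr
    _ = (36 * c₂ + 10 * κ + 30) * √(s / n) := by rw [← hs]; ring

theorem contractionWeights_mem_Icc (hw : IsTighteningFunction w) (hlam : 0 ≤ lam) (hu : 0 ≤ u)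
    (hwu : 1 / 2 ≤ w u) (hΛ₀ : Λ₀ = (fun _ => lam) ∨ Λ₀ = adaptiveWeights lam w 0) (j : Fin d) :
    Λ₀ j ∈ Set.Icc (lam / 2) lam := by
  rcases hΛ₀ with rfl | rfl
  · exact ⟨half_le_self hlam, le_rfl⟩
  · exact ⟨half_le_adaptiveWeights hw hlam hwu (by simpa using hu),
      (adaptiveWeights_mem_Icc hw hlam 0 j).2⟩

theorem mul_le_mul_threshold {δ : ℝ} (hρlo : 0 < ρlo) (hδ : 0 < δ) (hδ₁ : δ ≤ 1) (hlam : 0 ≤ lam) :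
    18 * lam ≤ ρlo * (18 * ρlo⁻¹ * δ⁻¹ * lam) :=
  calc 18 * lam ≤ 18 * (δ⁻¹ * lam) := by
        gcongr
        exact le_mul_of_one_le_left hlam ((one_le_inv₀ hδ).2 hδ₁)
    _ = ρlo * (18 * ρlo⁻¹ * δ⁻¹ * lam) := by field_simp

end StatisticalRate

end ILAMM

open ILAMM in
theorem corollary4p3_general {n d : ℕ} (hn : 1 ≤ n) (hd : 2 ≤ d)
    {X : Matrix (Fin n) (Fin d) ℝ} {βstar : EuclideanSpace ℝ (Fin d)}
    {Ω : Type*} [MeasurableSpace Ω] {μ : Measure Ω} [IsProbabilityMeasure μ] {e : Fin n → Ω → ℝ}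
    {w : ℝ → ℝ} {lam u τ ρlo ρhi c₂ εc εt : ℝ} {Λ₀ : Fin d → ℝ} {T : ℕ} {σ : NNReal}
    {y : EuclideanSpace ℝ (Fin n)} (hσ : 0 < σ) (hind : iIndepFun e μ)
    (hsub : ∀ i, HasSubgaussianMGF (e i) (σ ^ 2) μ)
    (hX : ∀ j, ‖(WithLp.toLp 2 (fun i => X i j) : EuclideanSpace ℝ (Fin n))‖ ≤ √n)
    (hLSE : LSECondition (quadLoss X y) βstar ρlo ρhi 2 (1 / 100))
    (hw : IsTighteningFunction w) (hwu : 1 / 2 ≤ w u) (hτ : 0 ≤ τ) (hwτ : w τ = 0)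
    (hsignal : ∀ j ∈ supp βstar, u + τ ≤ |βstar j|) (hlamu : 18 * lam ≤ ρlo * u)
    (hlam : (32 * σ + 32) * √(Real.log d / n) ≤ lam) (hlam' : lam ≤ c₂ * √(Real.log d / n))
    (hεc : εc ≤ lam / 8) (hεt : εt ≤ √(1 / n)) (hT : 1 ≤ T) (hT' : Real.log (Real.log d) ≤ T)
    (hΛ₀ : ∀ j, Λ₀ j ∈ Set.Icc (lam / 2) lam) :
    ∃ A, MeasurableSet A ∧
      1 - 2 * (d : ℝ) ^ (-1 : ℝ) - Real.exp (-(supp βstar).card) ≤ μ.real A ∧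
      ∀ ω ∈ A, ∀ b : ℕ → EuclideanSpace ℝ (Fin d),
        IsTACSequence (quadLoss X (response X βstar fun i => e i ω)) lam w Λ₀ εc εt T b →
        ‖b T - βstar‖ ≤ ρlo⁻¹ * (36 * c₂ + 10 * √(8 * σ ^ 2 * ρhi) + 30) *
          √((supp βstar).card / n) := by
  obtain ⟨_, _, _, hρlo, hlo, hmid, hhi, _⟩ := id hLSE
  have hσ' : (0 : ℝ) ≤ σ := σ.2
  have hrate : 0 ≤ √(Real.log d / n) := Real.sqrt_nonneg _
  rw [add_mul] at hlam
  have hσlam : 2 * σ * √(Real.log d / n) ≤ lam / 16 := by linarith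
  have hlam₀ : 32 * √(Real.log d / n) ≤ lam := by linarith [mul_nonneg hσ' hrate]
  have hvar : 4 * ((σ ^ 2 : NNReal) : ℝ) * (Real.log d / n) ≤ (lam / 16) ^ 2 :=
    calc 4 * ((σ ^ 2 : NNReal) : ℝ) * (Real.log d / n) = (2 * σ * √(Real.log d / n)) ^ 2 := by
          rw [mul_pow, Real.sq_sqrt (by positivity), NNReal.coe_pow]
          ring
      _ ≤ (lam / 16) ^ 2 := by gcongr
  obtain ⟨A, hA, hprob, hscore⟩ := exists_measurableSet_score_le hn (by omega) (by positivity)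
    hind hsub hX (by linarith) hvar
    (hρlo.trans_le (hlo.trans (hmid.trans hhi))) hLSE.sparseUpperBound
  refine ⟨A, hA, hprob, fun ω hω b hb => ?_⟩
  obtain ⟨hsup, hsupp⟩ := hscore ω hω
  rw [NNReal.coe_pow] at hsupp
  exact hb.norm_sub_le hn hd hLSE.restrictedEigenvalue hρlo hw hwu hτ hwτ hsignal hlamu hlam₀
    hlam' hεc hεt hΛ₀ hT hT' hsup hsupp

theorem corollary4p3 :
    ∀ δ : ℝ, 0 < δ → δ < 1 → ∃ cT : ℝ, 0 < cT ∧
    ∀ σ : NNReal, 0 < σ → ∃ c₀ : ℝ, 0 < c₀ ∧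
    ∀ c₁ c₂ ρlo ρhi : ℝ, c₀ ≤ c₁ → c₁ ≤ c₂ → 0 < ρlo → ρlo ≤ ρhi →
    ∃ η₁ η₂ K : ℝ, 0 < η₁ ∧ 0 < η₂ ∧ 0 < K ∧
    ∀ (n d : ℕ), 1 ≤ n → 2 ≤ d →
    ∀ (X : Matrix (Fin n) (Fin d) ℝ) (βstar : EuclideanSpace ℝ (Fin d))
      (Ω : Type*) [MeasurableSpace Ω] (μ : Measure Ω) [IsProbabilityMeasure μ]
      (e : Fin n → Ω → ℝ) (w : ℝ → ℝ) (lam γ εc εt : ℝ) (Λ₀ : Fin d → ℝ) (T : ℕ),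
    -- i.i.d. centred sub-Gaussian noise with variance proxy `σ²`
    iIndepFun e μ →
    (∀ i k, IdentDistrib (e i) (e k) μ μ) →
    (∀ i, HasSubgaussianMGF (e i) (σ ^ 2) μ) →
    -- column normalization
    (∀ j, ‖(WithLp.toLp 2 (fun i => X i j) : EuclideanSpace ℝ (Fin n))‖ ≤ √(n : ℝ)) →
    -- localized sparse eigenvalues (the Hessian of the quadratic loss does not depend on `ω`)
    (∀ ω, ILAMM.LSECondition
      (ILAMM.quadLoss X (ILAMM.response X βstar (fun i => e i ω))) βstar ρlo ρhi 2 (1 / 100)) →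
    -- tightening function, with `u = 18 ρ_*⁻¹ δ⁻¹ λ`
    ILAMM.IsTighteningFunction w →
    1 / 2 ≤ w (18 * ρlo⁻¹ * δ⁻¹ * lam) →
    -- minimal signal strength
    0 < γ →
    (∀ j ∈ ILAMM.supp βstar, 18 * ρlo⁻¹ * δ⁻¹ * lam + γ * lam ≤ |βstar j|) →
    w (γ * lam) = 0 →
    -- tuning parameters
    c₁ * √(Real.log d / n) ≤ lam → lam ≤ c₂ * √(Real.log d / n) →
    εc ≤ lam / 8 → εt ≤ √(1 / (n : ℝ)) →
    1 ≤ T → cT * Real.log (Real.log d) ≤ T →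
    -- contraction-stage weights `λ𝟏`, or `λ w(0) 𝟏` from the initial value `0`
    (Λ₀ = (fun _ => lam) ∨ Λ₀ = ILAMM.adaptiveWeights lam w (0 : EuclideanSpace ℝ (Fin d))) →
    ∃ A : Set Ω, MeasurableSet A ∧
      1 - 2 * (d : ℝ) ^ (-η₁) - 2 * Real.exp (-η₂ * ((ILAMM.supp βstar).card : ℝ)) ≤ μ.real A ∧
      ∀ ω ∈ A, ∀ b : ℕ → EuclideanSpace ℝ (Fin d),
        ILAMM.IsTACSequence (ILAMM.quadLoss X (ILAMM.response X βstar (fun i => e i ω)))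
          lam w Λ₀ εc εt T b →
        ‖b T - βstar‖ ≤ K * √(((ILAMM.supp βstar).card : ℝ) / n) := by
  refine fun δ hδ hδ₁ => ⟨1, one_pos, fun σ hσ => ⟨32 * σ + 32, by positivity,
    fun c₁ c₂ ρlo ρhi hc₁ hc₂ hρlo _ => ?_⟩⟩
  have hc₁' : 0 < c₁ := (by positivity : (0 : ℝ) < 32 * σ + 32).trans_le hc₁
  have hc₂' : 0 < c₂ := hc₁'.trans_le hc₂
  refine ⟨1, 1, ρlo⁻¹ * (36 * c₂ + 10 * √(8 * σ ^ 2 * ρhi) + 30), one_pos, one_pos,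
    by positivity, ?_⟩
  intro n d hn hd X βstar Ω _ μ _ e w lam γ εc εt Λ₀ T hind _ hsub hX hLSE hw hwu hγ hsignal hwγ
    hlam hlam' hεc hεt hT hT' hΛ₀
  rw [one_mul] at hT'
  have hlam₀ : 0 ≤ lam := (mul_nonneg hc₁'.le (Real.sqrt_nonneg _)).trans hlam
  obtain ⟨A, hA, hprob, herr⟩ := corollary4p3_general hn hd hσ hind hsub hX
    (hLSE (nonempty_of_isProbabilityMeasure μ).some) hw hwu (mul_nonneg hγ.le hlam₀) hwγ hsignal
    (ILAMM.mul_le_mul_threshold hρlo hδ hδ₁.le hlam₀) (le_trans (by gcongr) hlam) hlam' hεc hεt hT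
    hT' (ILAMM.contractionWeights_mem_Icc hw hlam₀ (by positivity) hwu hΛ₀)
  refine ⟨A, hA, ?_, herr⟩
  rw [neg_one_mul]
  linarith [Real.exp_pos (-(ILAMM.supp βstar).card : ℝ)]
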